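/- Let $p\neq 2$ be a prime number, $k$ a finite extension of $\mathbf F_p$ of degree $f=[k:\mathbf F_p]$, $V$ a $k$-vector space of dimension $2$, and $H\subset GL(V)$ a subgroup acting semisimply on $V$. Let $k_2$ be a quadratic extension of $k$. Let $H$ act on $\mathrm{End}_k(V)$ by conjugation, and let $\mathrm{End}_k^\circ(V)\subset\mathrm{End}_k(V)$ be the submodule of endomorphisms of trace $0$. For an odd integer $n>1$ let $D_{2n}$ be the dihedral group of order $2n$, $C_n\subset D_{2n}$ its cyclic subgroup of order $n$, and $s\in D_{2n}\smallsetminus C_n$ a fixed element. For a character $\psi:C_n\to k^\times$ put $I(\psi)=\mathrm{Ind}_{C_n}^{D_{2n}}(\psi)$. For a character $\psi':C_n\to\mathrm{Ker}(N_{k_2/k}:k_2^\times\to k^\times)$ let $J(\psi')$ be the representation of $D_{2n}$ on the two-dimensional $k$-vector space $k_2$ in which $g\in C_n$ acts as multiplication by $\psi'(g)$ and $s$ acts as the non-trivial element of $\mathrm{Gal}(k_2/k)$. An odd integer $n>1$ is called $k$-exceptional if either $n\mid p^f-1$ and there are $\varepsilon\in\{\pm1\}$ and $i\in\mathbf Z/f\mathbf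 Z$ with $p^i\equiv 2\varepsilon \pmod n$, or $n\mid p^f+1$ and there is $i\in\mathbf Z/2f\mathbf Z$ with $p^i\equiv 2\pmod n$. Then: (1) $H^i(H,V)=0$ for all $i>0$. (2) If $H$ acts irreducibly on $V$, then the following conditions are equivalent: (a) $\mathrm{Hom}_{\mathbf F_p}(W,V)^H=0$ for every $\mathbf F_p[H]$-submodule $W\subset\mathrm{End}_k(V)$; (b) $\mathrm{Hom}_{\mathbf F_p}(\mathrm{End}_k^\circ(V),V)^H=0$; (c) the pair $(H,\ \rho:H\hookrightarrow GL(V))$ is not isomorphic to a pair $(C_n, J(\psi')|_{C_n})$, $(D_{2n}, I(\psi))$ or $(D_{2n}, J(\psi'))$ for any $k$-exceptional $n>1$ and any characters $\psi$, $\psi'$ as above. -/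

import Mathlib

universe u

noncomputable section

namespace PlaneRep

/-- Restriction of the coefficients of a representation to a smaller ring `F`. -/
def restrictCoeff (F : Type*) {k G V : Type*} [CommSemiring F] [CommSemiring k] [Algebra F k]
    [Monoid G] [AddCommMonoid V] [Module k V] [Module F V] [IsScalarTower F k V]
    (ρ : Representation k G V) : Representation F G V where
  toFun g := (ρ g).restrictScalars F
  map_one' := by ext; simp
  map_mul' _ _ := by ext; simp

/-- `Hom_F(V, W)^G`, the `G`-invariant `F`-linear maps, where `g` acts by `φ ↦ g φ g⁻¹`. -/
abbrev homInvariants {F G V W : Type*} [CommRing F] [Group G]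
    [AddCommGroup V] [Module F V] [AddCommGroup W] [Module F W]
    (ρ : Representation F G V) (σ : Representation F G W) : Submodule F (V →ₗ[F] W) :=
  (ρ.linHom σ).invariants

section Tautological

variable {k V : Type*} [Field k] [AddCommGroup V] [Module k V]

/-- The tautological action on `V` of a subgroup `H` of `GL(V)`. -/
def tautRep (H : Subgroup (LinearMap.GeneralLinearGroup k V)) : Representation k H V :=
  (Units.coeHom (Module.End k V)).comp H.subtype

/-- The adjoint action `A ↦ h A h⁻¹` of `H` on `End_k(V)`, as a representation over `F ⊆ k`. -/
def adRep (F : Type*) [Field F] [Algebra F k] [Module F V] [IsScalarTower F k V]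
    (H : Subgroup (LinearMap.GeneralLinearGroup k V)) : Representation F H (Module.End k V) :=
  restrictCoeff F ((tautRep H).linHom (tautRep H))

/-- The `F[H]`-submodule `End_k^∘(V)` of `End_k(V)` of the endomorphisms of trace zero. -/
def adZero (F : Type*) [Field F] [Algebra F k] [Module F V] [IsScalarTower F k V]
    (H : Subgroup (LinearMap.GeneralLinearGroup k V)) : Subrepresentation (adRep F H) where
  toSubmodule := (LinearMap.ker (LinearMap.trace k V)).restrictScalars F
  apply_mem_toSubmodule h A hA := by
    have hA' : LinearMap.trace k V A = 0 := hA
    change LinearMap.trace k V ((h : LinearMap.GeneralLinearGroup k V).val *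
      (A * ((h⁻¹ : H) : LinearMap.GeneralLinearGroup k V).val)) = 0
    rw [LinearMap.trace_mul_comm, mul_assoc, ← Units.val_mul]
    simpa using hA'

/-- The pair consisting of `H` and its inclusion in `GL(V)` is isomorphic to the pair `(G, σ)`. -/
def IsOfForm {G U : Type*} [Group G] [AddCommGroup U] [Module k U]
    (H : Subgroup (LinearMap.GeneralLinearGroup k V)) (σ : Representation k G U) : Prop :=
  ∃ e : G ≃* H, Nonempty (σ.Equiv ((tautRep H).comp e.toMonoidHom))

end Tautological

/-- The cyclic group `C_n`. -/
abbrev Cyc (n : ℕ) : Type := Multiplicative (ZMod n)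

/-- The inclusion of `C_n` in the dihedral group `D_{2n}` (of order `2n`) as the rotations. -/
def rot (n : ℕ) : Cyc n →* DihedralGroup n where
  toFun a := DihedralGroup.r a.toAdd
  map_one' := rfl
  map_mul' _ _ := by simp

/-- A character of `C_n`, as a one-dimensional representation. -/
def charRep {k : Type*} [Field k] {n : ℕ} (ψ : Cyc n →* kˣ) : Representation k (Cyc n) k :=
  ((Algebra.lmul k k : k →* Module.End k k).comp (Units.coeHom k)).comp ψ

/-- `I(ψ)`, the representation of `D_{2n}` induced from the character `ψ` of `C_n`. -/
def repI {k : Type*} [Field k] {n : ℕ} (ψ : Cyc n →* kˣ) :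
    Representation k (DihedralGroup n) (Representation.IndV (rot n) (charRep ψ)) :=
  Representation.ind (rot n) (charRep ψ)

section NonSplit

variable (k k₂ : Type*) [Field k] [Field k₂] [Algebra k k₂]

/-- The kernel of the norm `k₂ˣ → kˣ`. -/
abbrev normOne : Subgroup k₂ˣ := (Units.map (Algebra.norm k : k₂ →* k)).ker

variable [Finite k]

/-- The `k`-linear map `x ↦ x ^ #k` of `k₂`. If `k₂` is a quadratic extension of `k`, this is the
non-trivial element of `Gal(k₂/k)`; it has eigenvalues `±1` and normalises `k₂ˣ ⊆ GL_k(k₂)`. -/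
def conj : Module.End k k₂ :=
  letI := Fintype.ofFinite k
  (FiniteField.frobeniusAlgHom k k₂).toLinearMap

theorem conj_apply (x : k₂) : conj k k₂ x = x ^ Nat.card k := by
  let _ := Fintype.ofFinite k
  simp [conj]

theorem conj_conj (h₂ : Module.finrank k k₂ = 2) : conj k k₂ * conj k k₂ = 1 := by
  have : Module.Finite k k₂ := Module.finite_of_finrank_eq_succ h₂
  have : Finite k₂ := Module.finite_of_finite k
  ext x
  have hc : Nat.card k₂ = Nat.card k * Nat.card k := by
    rw [Module.natCard_eq_pow_finrank (K := k) (V := k₂), h₂, sq]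
  let _ := Fintype.ofFinite k₂
  rw [Module.End.mul_apply, conj_apply, conj_apply, ← pow_mul, ← hc, Nat.card_eq_fintype_card,
    FiniteField.pow_card, Module.End.one_apply]

variable {k k₂}

theorem conj_normOne (h₂ : Module.finrank k k₂ = 2) (u : normOne k k₂) :
    conj k k₂ ((u : k₂ˣ) : k₂) = ((u⁻¹ : normOne k k₂) : k₂ˣ) := by
  have : Module.Finite k k₂ := Module.finite_of_finrank_eq_succ h₂
  have : Finite k₂ := Module.finite_of_finite k
  have hu : Algebra.norm k ((u : k₂ˣ) : k₂) = 1 := congrArg Units.val u.2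
  have h := FiniteField.algebraMap_norm_eq_prod_pow k k₂ ((u : k₂ˣ) : k₂)
  rw [hu, h₂] at h
  rw [conj_apply, InvMemClass.coe_inv, Units.val_inv_eq_inv_val]
  refine eq_inv_of_mul_eq_one_right ?_
  simpa [Finset.prod_range_succ] using h.symm

/-- Multiplication by the value at `a` of a character `ψ'` of `C_n` with values in the elements
of norm one of `k₂`. -/
def mulChar {n : ℕ} (ψ' : Cyc n →* normOne k k₂) (a : Cyc n) : Module.End k k₂ :=
  Algebra.lmul k k₂ (ψ' a : k₂ˣ)

theorem mulChar_one {n : ℕ} (ψ' : Cyc n →* normOne k k₂) : mulChar ψ' 1 = 1 := by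
  ext; simp [mulChar]

theorem mulChar_mul {n : ℕ} (ψ' : Cyc n →* normOne k k₂) (a b : Cyc n) :
    mulChar ψ' (a * b) = mulChar ψ' a * mulChar ψ' b := by
  ext; simp [mulChar, mul_assoc]

theorem mulChar_conj {n : ℕ} (h₂ : Module.finrank k k₂ = 2) (ψ' : Cyc n →* normOne k k₂)
    (a : Cyc n) : mulChar ψ' a * conj k k₂ = conj k k₂ * mulChar ψ' a⁻¹ := by
  ext x
  have h := conj_normOne h₂ (ψ' a⁻¹)
  rw [map_inv, inv_inv] at h
  rw [conj_apply] at h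
  simp only [Module.End.mul_apply, conj_apply, mulChar, Algebra.coe_lmul_eq_mul,
    LinearMap.mul_apply', mul_pow, map_inv, h]

/-- `J(ψ')`, for a quadratic extension `k₂` of `k`: the representation of `D_{2n}` on the `k`-vector
space `k₂` in which the rotation `r i` acts as multiplication by `ψ' i` and the reflection
`s = sr 0` acts as the non-trivial element of `Gal(k₂/k)` (note that `sr i = s * r i`). -/
def repJ (h₂ : Module.finrank k k₂ = 2) {n : ℕ} (ψ' : Cyc n →* normOne k k₂) :
    Representation k (DihedralGroup n) k₂ where
  toFun
    | .r i => mulChar ψ' (.ofAdd i)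
    | .sr i => conj k k₂ * mulChar ψ' (.ofAdd i)
  map_one' := mulChar_one ψ'
  map_mul' x y := by
    rcases x with i | i <;> rcases y with j | j
    · exact mulChar_mul ψ' _ _
    · change conj k k₂ * mulChar ψ' (.ofAdd (j - i)) = mulChar ψ' (.ofAdd i) * (conj k k₂ * _)
      rw [← mul_assoc, mulChar_conj h₂, mul_assoc, ← mulChar_mul, ← ofAdd_neg, ← ofAdd_add,
        neg_add_eq_sub]
    · change conj k k₂ * mulChar ψ' (.ofAdd (i + j)) = conj k k₂ * _ * _
      rw [mul_assoc, ← mulChar_mul, ← ofAdd_add]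
    · change mulChar ψ' (.ofAdd (j - i)) =
        conj k k₂ * mulChar ψ' (.ofAdd i) * (conj k k₂ * mulChar ψ' (.ofAdd j))
      rw [mul_assoc, ← mul_assoc (mulChar ψ' _), mulChar_conj h₂, mul_assoc, ← mul_assoc (conj k k₂),
        conj_conj k k₂ h₂, one_mul, ← mulChar_mul, ← ofAdd_neg, ← ofAdd_add, neg_add_eq_sub]

end NonSplit

/-- `n` is `k`-exceptional, where `k` has `p ^ f` elements and `p` is an odd prime. As `p ^ f` is
congruent to `1` (in the first case) or `-1` (in the second case) modulo `n`, the exponent `i` is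
taken in `ℤ/f` and `ℤ/2f`, respectively. -/
def IsExceptional (p : ℕ) (k : Type*) [Field k] [Algebra (ZMod p) k] (n : ℕ) : Prop :=
  Odd n ∧ 1 < n ∧
    ((n ∣ p ^ Module.finrank (ZMod p) k - 1 ∧
        ∃ ε : ℤˣ, ∃ i < Module.finrank (ZMod p) k, (p : ℤ) ^ i ≡ 2 * (ε : ℤ) [ZMOD (n : ℤ)]) ∨
      (n ∣ p ^ Module.finrank (ZMod p) k + 1 ∧
        ∃ i < 2 * Module.finrank (ZMod p) k, (p : ℤ) ^ i ≡ 2 [ZMOD (n : ℤ)]))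

end PlaneRep

end

/-!
The argument is elementary, and rests on the following observations. Let `q = p ^ f` be the number
of elements of `k`.

If `p` divides the order of `H`, then `-1 ∈ H` (`neg_one_mem_of_dvd_card`): by semisimplicity `H`
contains two transvections with different axes, and the group they generate has even order by a
count of fixed points on an orbit in the projective line. A central element acting as a scalar
`c ≠ 1` kills the cohomology in all positive degrees (`subsingleton_groupCohomology_of_central`); if
`p` does not divide the order of `H`, the cohomology vanishes because the trivial representation
is projective. For the same reasons the first two conditions of the second part are equivalent: a
scalar `c ≠ 1` in `H` acts trivially on endomorphisms and without nonzero fixed vectors on `V`, so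
that all equivariant maps vanish, and otherwise averaging extends an equivariant map from `W` to
`End_k(V)`.

Suppose now that `H` acts irreducibly, has order prime to `p`, and contains no scalars but `1`. A
count of traces in the style of Frobenius and Schur yields an endomorphism `A` with
`A ^ 2 = d ≠ 0` that each element of `H` commutes or anticommutes with (`exists_normalizesQuadratic`). The
elements commuting with `A` are of the form `a + b A` with `a ^ 2 - b ^ 2 d = 1`; they form a
cyclic group of odd order `n > 1`, on which `a + b A ↦ a + b α` with `α ^ 2 = d` is an injective
character. An element anticommuting with `A` is an involution inverting this group. Hence the pair
is `J(ψ')`, possibly restricted to `C_n`, if `d` is not a square in `k`, and `I(ψ)` if it is, by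
irreducibility.

A nonzero equivariant map from `End_k^∘(V)` to `V` forces `n` to be exceptional: a generator `g`
of the cyclic group has eigenvalues `ζ` and `ζ⁻¹` on `V`, and `1`, `ζ ^ 2`, `ζ⁻¹ ^ 2` on
endomorphisms. As the map is linear over the prime field, it relates eigenvalues up to conjugacy
over `𝔽_p`, so that `ζ ^ p ^ i = ζ ^ (± 2)` for some `i` (`exists_eq_pow_of_intertwines`).
Conversely, if `n` is exceptional, a suitable power of the Frobenius applied to the off-diagonal
part of an endomorphism, with respect to the eigenspaces of `g`, is a nonzero equivariant map. In
the nonsplit case this part is read off over `k₂` as the conjugation-semilinear part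
(`semilinearPart`).
-/

noncomputable section

namespace PlaneRep

open LinearMap (GeneralLinearGroup)

/-! ### Vanishing of cohomology -/

section Cohomology

open CategoryTheory

variable {k G : Type u}

/-- If the order of `G` is invertible in `k`, averaging over `G` turns a preimage of `1` under an
epimorphism into an invariant one. -/
theorem projective_trivial_of_card_ne_zero [Field k] [Group G] [Finite G]
    (hG : (Nat.card G : k) ≠ 0) : Projective (Rep.trivial k G k) where
  factors {E X} f e he := by
    have : Fintype G := Fintype.ofFinite G
    obtain ⟨y, hy⟩ := (Rep.epi_iff_surjective e).1 he (f.hom (1 : k))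
    let a : E := (Nat.card G : k)⁻¹ • ∑ g, E.ρ g y
    have ha (h : G) : E.ρ h a = a := by
      simp only [a, map_smul, map_sum]
      congr 1
      rw [← (Group.mulLeft_bijective h).sum_comp (fun g ↦ E.ρ g y)]
      simp
    have hfa (h : G) : X.ρ h (f.hom (1 : k)) = f.hom (1 : k) := by
      simpa using (Rep.hom_comm_apply f h (1 : k)).symm
    have hea : e.hom a = f.hom (1 : k) := by
      simp only [a, map_smul, map_sum, Rep.hom_comm_apply, hy, hfa]
      rw [Finset.sum_const, Finset.card_univ, ← Nat.card_eq_fintype_card,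
        ← Nat.cast_smul_eq_nsmul k, smul_smul, inv_mul_cancel₀ hG, one_smul]
    refine ⟨Rep.ofHom ⟨LinearMap.toSpanSingleton k E a, fun g ↦ ?_⟩, ?_⟩
    · ext; simp [ha]
    · ext; simp [hea]

theorem subsingleton_groupCohomology_of_card_ne_zero [Field k] [Group G] [Finite G]
    (hG : (Nat.card G : k) ≠ 0) (A : Rep k G) {n : ℕ} (hn : 0 < n) :
    Subsingleton (groupCohomology A n) := by
  have := projective_trivial_of_card_ne_zero hG
  obtain ⟨n, rfl⟩ := Nat.exists_eq_add_one.2 hn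
  exact ModuleCat.subsingleton_of_isZero
    ((isZero_Ext_succ_of_projective (Rep.trivial k G k) A n).of_iso (groupCohomologyIsoExt _ _))

/-- The action of a central element `z` of `G` on a representation, as an endomorphism of that
representation. It is natural in the representation, see `centralEnd_comp`. -/
def centralEnd [CommRing k] [Group G] {z : G} (hz : z ∈ Subgroup.center G) (A : Rep k G) : A ⟶ A :=
  Rep.ofHom ⟨A.ρ z, fun g ↦ by
    change A.ρ z * A.ρ g = A.ρ g * A.ρ z
    rw [← map_mul, ← map_mul, Subgroup.mem_center_iff.1 hz g]⟩

theorem centralEnd_comp [CommRing k] [Group G] {z : G} (hz : z ∈ Subgroup.center G) {A B : Rep k G}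
    (f : A ⟶ B) : centralEnd hz A ≫ f = f ≫ centralEnd hz B := by
  ext x
  exact Rep.hom_comm_apply f z x

/-- A central element acting on `A` as a scalar `c ≠ 1` kills the positive degree cohomology: its
action on a projective resolution of the trivial representation lifts the identity, hence is
homotopic to it, so that `c` acts as the identity on the cohomology of `A`. -/
theorem subsingleton_groupCohomology_of_central [Field k] [Group G] {z : G}
    (hz : z ∈ Subgroup.center G) (A : Rep k G) {c : k} (hc : c ≠ 1)
    (hA : A.ρ z = c • 1) {n : ℕ} (hn : 0 < n) : Subsingleton (groupCohomology A n) := by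
  obtain ⟨n, rfl⟩ := Nat.exists_eq_add_one.2 hn
  let P := Rep.barResolution k G
  let ζ : P.complex ⟶ P.complex :=
    { f := fun i ↦ centralEnd hz _
      comm' := fun i j _ ↦ centralEnd_comp hz _ }
  have hζ : ζ ≫ P.π = P.π ≫ (ChainComplex.single₀ (Rep k G)).map (𝟙 _) := by
    rw [CategoryTheory.Functor.map_id, Category.comp_id]
    refine HomologicalComplex.to_single_hom_ext ?_
    have h1 : (ζ ≫ P.π).f 0 = P.π.f 0 ≫ centralEnd hz _ := centralEnd_comp hz _
    rw [h1]
    convert Category.comp_id _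
    change centralEnd hz (Rep.trivial k G k) = 𝟙 _
    ext
    simp [centralEnd]
  -- both `ζ` and the identity lift the identity of the trivial representation
  have h := ProjectiveResolution.liftHomotopy (𝟙 _) ζ (𝟙 _) hζ (by simp)
  refine ModuleCat.subsingleton_of_isZero (Limits.IsZero.of_iso ?_ (groupCohomologyIso A _ P))
  rw [← HomologicalComplex.exactAt_iff_isZero_homology,
    HomologicalComplex.exactAt_iff' _ n (n + 1) (n + 2) (by simp) (by simp),
    ShortComplex.moduleCat_exact_iff]
  intro (f : P.complex.X (n + 1) ⟶ A) hf
  replace hf : P.complex.d (n + 2) (n + 1) ≫ f = 0 := hf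
  -- on a cocycle `f`, the homotopy exhibits `z f - f` as a coboundary
  have key : f ≫ centralEnd hz A = P.complex.d (n + 1) n ≫ h.hom n (n + 1) ≫ f + f := by
    have h2 := h.comm (n + 1)
    rw [dNext_eq h.hom (show (ComplexShape.down ℕ).Rel (n + 1) n from rfl),
      prevD_eq h.hom (show (ComplexShape.down ℕ).Rel (n + 2) (n + 1) from rfl)] at h2
    rw [← centralEnd_comp hz f]
    change ζ.f (n + 1) ≫ f = _
    rw [h2]
    simp [hf]
  have hcA : f ≫ centralEnd hz A = c • f := by
    ext x
    simp [centralEnd, hA]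
    rfl
  refine ⟨(c - 1)⁻¹ • (h.hom n (n + 1) ≫ f), ?_⟩
  change P.complex.d (n + 1) n ≫ ((c - 1)⁻¹ • (h.hom n (n + 1) ≫ f)) = f
  rw [Linear.comp_smul, eq_sub_of_add_eq (key.symm.trans hcA), inv_smul_eq_iff₀ (sub_ne_zero.2 hc),
    sub_smul, one_smul]

end Cohomology

/-! ### Endomorphisms of a plane -/

section Plane

variable {k V : Type*} [Field k] [AddCommGroup V] [Module k V]

/-- The Cayley-Hamilton theorem for a plane. -/
theorem mul_self_eq_of_finrank_eq_two (hV : Module.finrank k V = 2) (A : Module.End k V) :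
    A * A = LinearMap.trace k V A • A - LinearMap.det A • 1 := by
  have : Module.Finite k V := Module.finite_of_finrank_eq_succ hV
  let b := Module.finBasisOfFinrankEq k V hV
  have h := LinearMap.aeval_self_charpoly A
  rw [← LinearMap.charpoly_toMatrix A b, Matrix.charpoly_fin_two,
    ← LinearMap.trace_eq_matrix_trace k b, LinearMap.det_toMatrix b] at h
  simp only [map_add, map_sub, map_mul, Polynomial.aeval_C, Polynomial.aeval_X_pow,
    Polynomial.aeval_X] at h
  rw [Algebra.algebraMap_eq_smul_one, Algebra.algebraMap_eq_smul_one, smul_mul_assoc, one_mul,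
    sq] at h
  rw [← sub_eq_zero, ← h]
  abel

theorem trace_one_of_finrank_eq_two (hV : Module.finrank k V = 2) :
    LinearMap.trace k V 1 = 2 := by
  have : Module.Finite k V := Module.finite_of_finrank_eq_succ hV
  rw [LinearMap.trace_one, hV]; norm_num

theorem exists_eq_smul_add_smul (hV : Module.finrank k V = 2) {a b : V}
    (h : LinearIndependent k ![a, b]) (w : V) : ∃ x y : k, w = x • a + y • b := by
  have : Module.Finite k V := Module.finite_of_finrank_eq_succ hV
  have h1 := h.span_eq_top_of_card_eq_finrank (by simp [hV])
  have h2 : w ∈ Submodule.span k (Set.range ![a, b]) := h1 ▸ Submodule.mem_top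
  rw [Matrix.range_cons_cons_empty, Submodule.mem_span_pair] at h2
  obtain ⟨x, y, h⟩ := h2
  exact ⟨x, y, h.symm⟩

theorem end_ext_of_linearIndependent (hV : Module.finrank k V = 2) {a b : V}
    (h : LinearIndependent k ![a, b]) {A B : Module.End k V} (h1 : A a = B a) (h2 : A b = B b) :
    A = B := by
  ext w
  obtain ⟨x, y, rfl⟩ := exists_eq_smul_add_smul hV h w
  simp [h1, h2]

theorem exists_linearIndependent_apply (A : Module.End k V)
    (hA : ∀ c : k, A ≠ c • 1) : ∃ v, LinearIndependent k ![v, A v] := by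
  by_contra! h
  obtain ⟨c, hc⟩ := LinearMap.exists_eq_smul_id_of_forall_notLinearIndependent h
  exact hA c hc

/-- The centraliser of a non-scalar endomorphism `A` of a plane is `k[A]`. -/
theorem exists_eq_of_commute (hV : Module.finrank k V = 2) {A B : Module.End k V}
    (hA : ∀ c : k, A ≠ c • 1) (hAB : B * A = A * B) : ∃ a b : k, B = a • 1 + b • A := by
  obtain ⟨v, hv⟩ := exists_linearIndependent_apply A hA
  obtain ⟨a, b, hab⟩ := exists_eq_smul_add_smul hV hv (B v)
  refine ⟨a, b, end_ext_of_linearIndependent hV hv (by simpa using hab) ?_⟩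
  have : B (A v) = A (B v) := congr($hAB v)
  rw [this, hab]
  simp

theorem isNilpotent_mul_self_eq_zero (hV : Module.finrank k V = 2) {A : Module.End k V}
    (hA : IsNilpotent A) : A * A = 0 := by
  have : Module.Finite k V := Module.finite_of_finrank_eq_succ hV
  have h1 : LinearMap.trace k V A = 0 := (LinearMap.isNilpotent_trace_of_isNilpotent hA).eq_zero
  have h2 : LinearMap.det A = 0 := by
    obtain ⟨n, hn⟩ := hA
    have := congr(LinearMap.det $hn)
    rw [map_pow, LinearMap.det_zero, hV] at this
    exact eq_zero_of_pow_eq_zero (n := n) (by simpa using this)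
  rw [mul_self_eq_of_finrank_eq_two hV, h1, h2]
  simp

theorem trace_eq_zero_of_anticommute (h2 : (2 : k) ≠ 0) {A s : Module.End k V} {d : k} (hd : d ≠ 0)
    (hA : A * A = d • 1) (hs : s * A = -(A * s)) : LinearMap.trace k V s = 0 := by
  have h1 : LinearMap.trace k V (s * A * A) = -LinearMap.trace k V (s * A * A) := by
    nth_rw 1 [hs]
    rw [neg_mul, map_neg, mul_assoc A, LinearMap.trace_mul_comm k A]
  rwa [mul_assoc, hA, mul_smul_comm, mul_one, map_smul, smul_eq_mul, ← sub_eq_zero,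
    sub_neg_eq_add, ← two_mul, mul_eq_zero, or_iff_right h2, mul_eq_zero, or_iff_right hd] at h1

theorem neg_one_ne_one [Nontrivial V] (h2 : (2 : k) ≠ 0) :
    (-1 : GeneralLinearGroup k V) ≠ 1 := fun h ↦ by
  have h1 : (2 : k) • (1 : Module.End k V) = 0 := by
    have h3 : (-1 : Module.End k V) = 1 := congrArg Units.val h
    rw [two_smul]
    nth_rw 1 [← h3]
    rw [neg_add_cancel]
  exact (smul_eq_zero.1 h1).elim h2 one_ne_zero

/-- In the special linear group of a plane in odd characteristic, `-1` is the only involution. -/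
theorem eq_neg_one_of_mul_self_eq_one (hV : Module.finrank k V = 2) (h2 : (2 : k) ≠ 0)
    {A : Module.End k V} (hA : A * A = 1) (hdet : LinearMap.det A = 1) (h1 : A ≠ 1) : A = -1 := by
  have : Nontrivial V := Module.nontrivial_of_finrank_pos (R := k) (by omega)
  have h := mul_self_eq_of_finrank_eq_two hV A
  rw [hA, hdet, one_smul, eq_sub_iff_add_eq] at h
  set t := LinearMap.trace k V A
  have ht : t ≠ 0 := by
    rintro ht
    rw [ht, zero_smul, ← two_smul k, smul_eq_zero] at h
    simp [h2] at h
  obtain ⟨c, rfl⟩ : ∃ c : k, A = c • 1 := ⟨t⁻¹ * 2, by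
    rw [mul_smul, two_smul, h, smul_smul, inv_mul_cancel₀ ht, one_smul]⟩
  have hc : c * c = 1 := by
    rw [smul_mul_smul_comm, one_mul] at hA
    have := (smul_left_injective k (one_ne_zero (α := Module.End k V)))
      (hA.trans (one_smul k 1).symm)
    exact this
  rcases mul_self_eq_one_iff.1 hc with rfl | rfl
  · simp at h1
  · simp

end Plane

/-! ### Quadratic extensions of a finite field in odd characteristic -/

section QuadraticExtension

variable {k k₂ : Type*} [Field k] [Field k₂] [Algebra k k₂]

theorem ringChar_ne_two (h2 : (2 : k) ≠ 0) : ringChar k ≠ 2 := fun h ↦ h2 (by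
  have := ringChar.Nat.cast_ringChar (R := k)
  rw [h] at this
  exact_mod_cast this)

theorem two_ne_zero_of_algebra (k₂ : Type*) [Field k₂] [Algebra k k₂] (h2 : (2 : k) ≠ 0) :
    (2 : k₂) ≠ 0 := by
  rw [← map_ofNat (algebraMap k k₂) 2]
  exact (map_ne_zero _).2 h2

theorem natCard_eq_two_mul_add_one [Finite k] (h2 : (2 : k) ≠ 0) :
    Nat.card k = 2 * (Nat.card k / 2) + 1 := by
  let _ := Fintype.ofFinite k
  rw [Nat.card_eq_fintype_card]
  exact (Nat.two_mul_div_two_add_one_of_odd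
    (Nat.odd_iff.2 (FiniteField.odd_card_of_char_ne_two (ringChar_ne_two h2)))).symm

theorem natCard_eq_mul_self (h₂ : Module.finrank k k₂ = 2) :
    Nat.card k₂ = Nat.card k * Nat.card k := by
  have : Module.Finite k k₂ := Module.finite_of_finrank_eq_succ h₂
  rw [Module.natCard_eq_pow_finrank (K := k) (V := k₂), h₂, sq]

theorem pow_natCard_sub_one [Finite k] {d : k} (hd : d ≠ 0) : d ^ (Nat.card k - 1) = 1 := by
  let _ := Fintype.ofFinite k
  rw [Nat.card_eq_fintype_card]
  exact FiniteField.pow_card_sub_one_eq_one d hd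

theorem exists_mul_self_eq_algebraMap [Finite k] (h₂ : Module.finrank k k₂ = 2) (h2 : (2 : k) ≠ 0)
    (d : k) :
    ∃ α : k₂, α * α = algebraMap k k₂ d := by
  by_cases hd : d = 0
  · exact ⟨0, by simp [hd]⟩
  have : Module.Finite k k₂ := Module.finite_of_finrank_eq_succ h₂
  have : Finite k₂ := Module.finite_of_finite k
  let _ := Fintype.ofFinite k₂
  obtain ⟨α, hα⟩ := (FiniteField.isSquare_iff (a := algebraMap k k₂ d)
    (ringChar_ne_two (two_ne_zero_of_algebra k₂ h2)) ((map_ne_zero _).2 hd)).2 (by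
      rw [← Nat.card_eq_fintype_card, natCard_eq_mul_self h₂]
      have h := natCard_eq_two_mul_add_one h2
      have h3 : Nat.card k * Nat.card k / 2 = (Nat.card k - 1) * (Nat.card k / 2 + 1) := by
        set m := Nat.card k / 2
        rw [h, Nat.add_sub_cancel]
        have : (2 * m + 1) * (2 * m + 1) = 2 * (2 * m * (m + 1)) + 1 := by ring
        omega
      rw [h3, pow_mul, ← map_pow, pow_natCard_sub_one hd, map_one, one_pow])
  exact ⟨α, hα.symm⟩

/-- By Euler's criterion, the conjugation of `k₂` negates the square roots of non-squares of `k`. -/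
theorem conj_eq_neg_of_mul_self [Finite k] (h2 : (2 : k) ≠ 0) {d : k}
    (hd : ∀ c, d ≠ c * c) {α : k₂} (hα : α * α = algebraMap k k₂ d) : conj k k₂ α = -α := by
  have hd0 : d ≠ 0 := fun h ↦ hd 0 (by simp [h])
  let _ := Fintype.ofFinite k
  rw [conj_apply, natCard_eq_two_mul_add_one h2, pow_succ, pow_mul, sq, hα, ← map_pow,
    Nat.card_eq_fintype_card,
    (FiniteField.pow_dichotomy (ringChar_ne_two h2) hd0).resolve_left, map_neg, map_one,
      neg_one_mul]
  intro h
  obtain ⟨c, hc⟩ := (FiniteField.isSquare_iff (ringChar_ne_two h2) hd0).2 h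
  exact hd c hc

theorem linearIndependent_one_of_mul_self {d : k}
    (hd : ∀ c, d ≠ c * c) {α : k₂} (hα : α * α = algebraMap k k₂ d) :
    LinearIndependent k ![1, α] := by
  rw [LinearIndependent.pair_iff' one_ne_zero]
  rintro c rfl
  rw [← Algebra.algebraMap_eq_smul_one, ← map_mul] at hα
  exact hd c ((algebraMap k k₂).injective hα).symm

theorem conj_algebraMap_add_mul [Finite k] (h2 : (2 : k) ≠ 0) {d : k}
    (hd : ∀ c, d ≠ c * c) {α : k₂} (hα : α * α = algebraMap k k₂ d) (a b : k) :
    conj k k₂ (algebraMap k k₂ a + algebraMap k k₂ b * α) =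
      algebraMap k k₂ a - algebraMap k k₂ b * α := by
  rw [map_add, ← Algebra.smul_def, map_smul, Algebra.algebraMap_eq_smul_one, map_smul,
    conj_eq_neg_of_mul_self h2 hd hα]
  rw [conj_apply, one_pow, smul_neg, sub_eq_add_neg]

theorem norm_eq_one_iff [Finite k] (h₂ : Module.finrank k k₂ = 2) (x : k₂) :
    Algebra.norm k x = 1 ↔ x * conj k k₂ x = 1 := by
  have : Module.Finite k k₂ := Module.finite_of_finrank_eq_succ h₂
  have : Finite k₂ := Module.finite_of_finite k
  have h := FiniteField.algebraMap_norm_eq_prod_pow k k₂ x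
  rw [h₂] at h
  simp only [Finset.prod_range_succ, Finset.prod_range_zero, pow_zero, pow_one, one_mul] at h
  rw [conj_apply, ← h]
  exact ((map_eq_one_iff _ (algebraMap k k₂).injective)).symm

end QuadraticExtension

/-! ### Semisimple groups of order divisible by the characteristic -/

section Transvections
open scoped LinearAlgebra.Projectivization

variable {k V : Type*} [Field k] [AddCommGroup V] [Module k V]

theorem apply_eq_self_of_sub_one_mul_self {A : Module.End k V} (hA : (A - 1) * (A - 1) = 0)
    {w : V} {a : k} (h : A w = a • w) : A w = w := by
  by_cases hw : w = 0
  · simp [hw]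
  have h1 : ((A - 1) * (A - 1)) w = ((a - 1) * (a - 1)) • w := by
    simp [Module.End.mul_apply, h, sub_smul, mul_smul, mul_sub, sub_mul]
  rw [hA, LinearMap.zero_apply, eq_comm, smul_eq_zero, mul_self_eq_zero, sub_eq_zero] at h1
  rw [h, h1.resolve_right hw, one_smul]

theorem exists_apply_eq_add_smul (hV : Module.finrank k V = 2) {A : Module.End k V}
    (hA : (A - 1) * (A - 1) = 0) {a b : V} (hab : LinearIndependent k ![a, b]) (ha : A a = a) :
    ∃ c : k, A b = b + c • a := by
  obtain ⟨x, y, h⟩ := exists_eq_smul_add_smul hV hab (A b - b)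
  by_cases hy : y = 0
  · exact ⟨x, by rw [← sub_eq_iff_eq_add', h, hy, zero_smul, add_zero]⟩
  · have h1 : (A - 1) (A b - b) = 0 := congr($hA b)
    rw [h, map_add, map_smul, map_smul, LinearMap.sub_apply, ha, Module.End.one_apply, sub_self,
      smul_zero, zero_add, smul_eq_zero, or_iff_right hy, LinearMap.sub_apply,
      Module.End.one_apply, sub_eq_zero] at h1
    exact ⟨0, by rw [h1]; simp⟩

/-- The group `G` generated by two transvections `u`, `v` of order `p` with distinct axes has even
order in odd characteristic. The orbit `O` of the axis of `u` in the projective line contains the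
axis of `v`: otherwise, counting fixed points, `#O ≡ 1` because of `u` and `#O ≡ 0` because of `v`
modulo `p`. The reflection which is `1` on the first axis and `-1` on the second inverts `u` and
`v`, hence acts on `O`; as the two axes are its only fixed points, `#O` is even. -/
theorem even_card_of_transvections [Finite k] (hV : Module.finrank k V = 2) (h2 : (2 : k) ≠ 0)
    {p : ℕ} [Fact p.Prime]
    (G : Subgroup (GeneralLinearGroup k V)) {u v : GeneralLinearGroup k V}
    (hG : G = Subgroup.closure {u, v}) (hup : u ^ p = 1) (hvp : v ^ p = 1)
    (hu : (u.val - 1) * (u.val - 1) = 0) (hv : (v.val - 1) * (v.val - 1) = 0)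
    {a b : V} (hab : LinearIndependent k ![a, b]) (hua : u.val a = a) (hvb : v.val b = b)
    (hub : u.val b ≠ b) (hva : v.val a ≠ a) : Even (Nat.card G) := by
  classical
  have : Module.Finite k V := Module.finite_of_finrank_eq_succ hV
  have : Finite V := Module.finite_of_finite k
  have ha0 : a ≠ 0 := hab.ne_zero 0
  have hb0 : b ≠ 0 := hab.ne_zero 1
  have hab' : ∀ x y : k, x • a + y • b = 0 → x = 0 ∧ y = 0 := LinearIndependent.pair_iff.1 hab
  have huG : u ∈ G := hG ▸ Subgroup.subset_closure (by simp)
  have hvG : v ∈ G := hG ▸ Subgroup.subset_closure (by simp)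
  let L : ℙ k V := .mk k a ha0
  let M : ℙ k V := .mk k b hb0
  have hLM : L ≠ M := by
    intro h
    obtain ⟨c, hc⟩ := (Projectivization.mk_eq_mk_iff' k a b ha0 hb0).1 h
    have := hab' 1 (-c) (by rw [neg_smul, hc]; simp)
    exact one_ne_zero this.1
  have fixed (g : GeneralLinearGroup k V) (w : V) (hw : w ≠ 0)
      (h : g • Projectivization.mk k w hw = .mk k w hw) :
      ∃ c : k, g.val w = c • w := by
    rw [Projectivization.smul_mk, Projectivization.mk_eq_mk_iff'] at h
    obtain ⟨c, hc⟩ := h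
    exact ⟨c, hc.symm⟩
  -- the only fixed point of `u` is `L`, that of `v` is `M`
  have fixU (x : ℙ k V) (hx : u • x = x) : x = L := by
    induction x using Projectivization.ind with | h w hw
    obtain ⟨c, hc⟩ := fixed u w hw hx
    have h1 := apply_eq_self_of_sub_one_mul_self hu hc
    obtain ⟨x, y, rfl⟩ := exists_eq_smul_add_smul hV hab w
    by_cases hy : y = 0
    · subst hy
      exact (Projectivization.mk_eq_mk_iff' k _ _ _ _).2 ⟨x, by simp⟩
    · simp only [map_add, map_smul, hua, add_right_inj] at h1
      exact absurd ((smul_right_injective V hy) h1) hub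
  have fixV (x : ℙ k V) (hx : v • x = x) : x = M := by
    induction x using Projectivization.ind with | h w hw
    obtain ⟨c, hc⟩ := fixed v w hw hx
    have h1 := apply_eq_self_of_sub_one_mul_self hv hc
    obtain ⟨x, y, rfl⟩ := exists_eq_smul_add_smul hV hab w
    by_cases hy : x = 0
    · subst hy
      exact (Projectivization.mk_eq_mk_iff' k _ _ _ _).2 ⟨y, by simp⟩
    · simp only [map_add, map_smul, hvb, add_left_inj] at h1
      exact absurd ((smul_right_injective V hy) h1) hva
  -- the fixed point congruence for an element of order dividing a prime
  have hcard (g : GeneralLinearGroup k V) (O : Set (ℙ k V)) (hO : ∀ x ∈ O, g • x ∈ O) (q : ℕ)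
      [Fact q.Prime]
      (hg : g ^ q = 1) : Nat.card O ≡ Nat.card {x // x ∈ O ∧ g • x = x} [MOD q] := by
    have : Fintype O := Fintype.ofFinite O
    let f : Function.End O := fun x ↦ ⟨g • x.1, hO _ x.2⟩
    have hf (n : ℕ) (x : O) : ((f ^ n) x).1 = g ^ n • x.1 := by
      induction n with
      | zero => exact (one_smul _ _).symm
      | succ n ih =>
        rw [pow_succ', pow_succ', mul_smul, ← ih]
        rfl
    have := Equiv.Perm.card_fixedPoints_modEq (f := f) (p := q) (n := 1) (by
      refine funext fun x ↦ Subtype.ext ?_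
      rw [pow_one, hf, hg, one_smul]; rfl)
    rw [← Nat.card_eq_fintype_card, ← Nat.card_eq_fintype_card] at this
    refine this.trans (congrArg (· % q) ?_)
    exact Nat.card_congr ⟨fun x ↦ ⟨x.1.1, x.1.2, congrArg Subtype.val x.2⟩,
      fun x ↦ ⟨⟨x.1, x.2.1⟩, Subtype.ext x.2.2⟩, fun _ ↦ rfl, fun _ ↦ rfl⟩
  let O : Set (ℙ k V) := MulAction.orbit G L
  have hGO (g : GeneralLinearGroup k V) (hg : g ∈ G) (x) (hx : x ∈ O) : g • x ∈ O := by
    obtain ⟨h, rfl⟩ := hx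
    exact ⟨⟨g, hg⟩ * h, mul_smul _ _ _⟩
  have hLO : L ∈ O := MulAction.mem_orbit_self L
  have huL : u • L = L := (Projectivization.mk_eq_mk_iff' k _ _ _ _).2 ⟨1, by
    rw [one_smul]; exact hua.symm⟩
  have hMO : M ∈ O := by
    by_contra hM
    have h3 := hcard u O (hGO u huG) p hup
    have h4 := hcard v O (hGO v hvG) p hvp
    have h5 : Nat.card {x // x ∈ O ∧ u • x = x} = 1 := by
      rw [Nat.card_eq_one_iff_exists]
      exact ⟨⟨L, hLO, huL⟩, fun y ↦ Subtype.ext (fixU _ y.2.2)⟩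
    have h6 : Nat.card {x // x ∈ O ∧ v • x = x} = 0 := by
      rw [Nat.card_eq_zero]
      exact .inl ⟨fun y ↦ hM (fixV _ y.2.2 ▸ y.2.1)⟩
    rw [h5] at h3
    rw [h6] at h4
    have := (h3.symm.trans h4)
    rw [Nat.modEq_zero_iff_dvd] at this
    exact (Fact.out : p.Prime).one_lt.ne' (Nat.dvd_one.1 this)
  -- the reflection `σ` which is `1` on `L` and `-1` on `M`
  let B := basisOfLinearIndependentOfCardEqFinrank hab (by simp [hV])
  have hB0 : B 0 = a := by simp [B]
  have hB1 : B 1 = b := by simp [B]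
  let s : Module.End k V := B.constr k ![a, -b]
  have hsa : s a = a := by rw [← hB0, Module.Basis.constr_basis]; simp [hB0]
  have hsb : s b = -b := by rw [← hB1, Module.Basis.constr_basis]; simp [hB1]
  have hss : s * s = 1 := end_ext_of_linearIndependent hV hab
    (by simp [Module.End.mul_apply, hsa]) (by simp [Module.End.mul_apply, hsb])
  let σ : GeneralLinearGroup k V := ⟨s, s, hss, hss⟩
  have hσσ : σ * σ = 1 := Units.ext hss
  have hσi : σ⁻¹ = σ := rfl
  have hσu : σ * u * σ⁻¹ = u⁻¹ := by
    rw [eq_inv_iff_mul_eq_one]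
    obtain ⟨c, hc⟩ := exists_apply_eq_add_smul hV hu hab hua
    refine Units.ext (end_ext_of_linearIndependent hV hab ?_ ?_)
    · change s (u.val (s (u.val a))) = a
      rw [hua, hsa, hua, hsa]
    · change s (u.val (s (u.val b))) = b
      simp [hc, hua, hsa, hsb]
  have hσv : σ * v * σ⁻¹ = v⁻¹ := by
    rw [eq_inv_iff_mul_eq_one]
    obtain ⟨c, hc⟩ := exists_apply_eq_add_smul hV hv (LinearIndependent.pair_symm_iff.1 hab) hvb
    refine Units.ext (end_ext_of_linearIndependent hV hab ?_ ?_)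
    · change s (v.val (s (v.val a))) = a
      simp [hc, hvb, hsa, hsb]
    · change s (v.val (s (v.val b))) = b
      simp [hvb, hsb]
  have hσG (g : GeneralLinearGroup k V) (hg : g ∈ G) : σ * g * σ⁻¹ ∈ G := by
    have : G.map (MulAut.conj σ).toMonoidHom ≤ G := by
      conv_lhs => rw [hG]
      rw [MonoidHom.map_closure, Subgroup.closure_le]
      rintro _ ⟨x, rfl | rfl, rfl⟩
      · change σ * _ * σ⁻¹ ∈ G
        exact hσu ▸ inv_mem huG
      · change σ * _ * σ⁻¹ ∈ G
        exact hσv ▸ inv_mem hvG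
    exact this ⟨g, hg, rfl⟩
  have hσL : σ • L = L := (Projectivization.mk_eq_mk_iff' k _ _ _ _).2 ⟨1, by
    rw [one_smul]; exact hsa.symm⟩
  have hσM : σ • M = M := (Projectivization.mk_eq_mk_iff' k _ _ _ _).2 ⟨-1, by
    rw [neg_one_smul]; exact hsb.symm⟩
  have hσO (x) (hx : x ∈ O) : σ • x ∈ O := by
    obtain ⟨h, rfl⟩ := hx
    refine ⟨⟨_, hσG h h.2⟩, ?_⟩
    change (σ * h.1 * σ⁻¹) • L = σ • (h.1 • L)
    rw [← hσL, ← mul_smul, ← mul_smul, inv_mul_cancel_right, hσL, mul_smul]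
  have hfix (x : ℙ k V) (hx : σ • x = x) : x = L ∨ x = M := by
    induction x using Projectivization.ind with | h w hw
    obtain ⟨c, hc⟩ := fixed σ w hw hx
    obtain ⟨x, y, rfl⟩ := exists_eq_smul_add_smul hV hab w
    change s _ = _ at hc
    by_cases hy : x = 0
    · subst hy
      exact .inr ((Projectivization.mk_eq_mk_iff' k _ _ _ _).2 ⟨y, by simp⟩)
    by_cases hy' : y = 0
    · subst hy'
      exact .inl ((Projectivization.mk_eq_mk_iff' k _ _ _ _).2 ⟨x, by simp⟩)
    simp only [map_add, map_smul, hsa, hsb] at hc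
    have h7 := hab' (x - c * x) (-y - c * y) (by
      rw [← sub_eq_zero.2 hc]
      module)
    have h8 : c = 1 := by
      have : x * (1 - c) = 0 := by linear_combination h7.1
      exact (sub_eq_zero.1 ((mul_eq_zero.1 this).resolve_left hy)).symm
    have h9 : y * 2 = 0 := by rw [h8] at h7; linear_combination -h7.2
    exact absurd h9 (mul_ne_zero hy' h2)
  have h10 := hcard σ O hσO 2 (by rw [sq, hσσ])
  have h11 : Nat.card {x // x ∈ O ∧ σ • x = x} = 2 := by
    rw [Nat.card_eq_two_iff]
    refine ⟨⟨L, hLO, hσL⟩, ⟨M, hMO, hσM⟩, fun h ↦ hLM congr(($h).1), ?_⟩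
    ext x
    simpa [Subtype.ext_iff] using hfix _ x.2.2
  rw [h11] at h10
  have h12 : 2 ∣ Nat.card O := (Nat.modEq_zero_iff_dvd.1 (h10.trans (by rfl)))
  rw [Nat.card_coe_set_eq, ← MulAction.index_stabilizer] at h12
  exact even_iff_two_dvd.2 (h12.trans (Subgroup.index_dvd_card _))

theorem neg_one_mem_of_even (hV : Module.finrank k V = 2) (h2 : (2 : k) ≠ 0)
    {G : Subgroup (GeneralLinearGroup k V)}
    [Finite G] (hdet : ∀ g ∈ G, LinearMap.det g.val = 1) (hG : Even (Nat.card G)) : -1 ∈ G := by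
  obtain ⟨g, hg⟩ := exists_prime_orderOf_dvd_card' 2 (even_iff_two_dvd.1 hG)
  have hg2 : g.1 ^ 2 = 1 := by
    rw [← Subgroup.coe_pow, ← hg, pow_orderOf_eq_one, Subgroup.coe_one]
  have h := eq_neg_one_of_mul_self_eq_one hV h2 (A := g.1.val)
    (by rw [← sq, ← Units.val_pow_eq_pow_val, hg2, Units.val_one]) (hdet _ g.2) (by
      intro h
      have : g = 1 := Subtype.ext (Units.ext h)
      rw [this, orderOf_one] at hg
      omega)
  have : g.1 = -1 := Units.ext h
  exact this ▸ g.2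

/-- An element `u` of order `p` is a transvection. By semisimplicity its axis is not stable under
`H`, so that a conjugate of `u` is a transvection with a different axis and
`even_card_of_transvections` applies. -/
theorem neg_one_mem_of_dvd_card [Finite k] (hV : Module.finrank k V = 2) (h2 : (2 : k) ≠ 0)
    (p : ℕ) [Fact p.Prime] [CharP k p] (H : Subgroup (GeneralLinearGroup k V))
    (hH : (tautRep H).IsSemisimpleRepresentation) (hpH : p ∣ Nat.card H) : -1 ∈ H := by
  have : Module.Finite k V := Module.finite_of_finrank_eq_succ hV
  have : Finite V := Module.finite_of_finite k
  have : Finite (Module.End k V) := Finite.of_injective _ DFunLike.coe_injective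
  have : Nontrivial V := Module.nontrivial_of_finrank_pos (R := k) (by omega)
  have : CharP (Module.End k V) p := charP_of_injective_algebraMap' k p
  have : ExpChar (Module.End k V) p := .prime Fact.out
  have : ExpChar k p := .prime Fact.out
  obtain ⟨⟨u, huH⟩, hu⟩ := exists_prime_orderOf_dvd_card' p hpH
  rw [Subgroup.orderOf_mk] at hu
  have hup : u ^ p = 1 := hu ▸ pow_orderOf_eq_one u
  have sqz (g : GeneralLinearGroup k V) (hg : g ^ p = 1) : (g.val - 1) * (g.val - 1) = 0 := by
    refine isNilpotent_mul_self_eq_zero hV ⟨p, ?_⟩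
    rw [sub_pow_expChar_of_commute _ (Commute.one_right _), one_pow,
      ← Units.val_pow_eq_pow_val, hg, Units.val_one, sub_self]
  have hdet (g : GeneralLinearGroup k V) (hg : g ^ p = 1) : LinearMap.det g.val = 1 := by
    have h : LinearMap.det g.val ^ p = 1 := by
      rw [← map_pow, ← Units.val_pow_eq_pow_val, hg, Units.val_one, map_one]
    rw [← sub_eq_zero]
    refine eq_zero_of_pow_eq_zero (n := p) ?_
    rw [sub_pow_expChar, h, one_pow, sub_self]
  have hu1 : u.val ≠ 1 := by
    intro h
    have : u = 1 := Units.ext h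
    rw [this, orderOf_one] at hu
    exact (Fact.out : p.Prime).one_lt.ne hu
  -- a complement of a stable `ker (u - 1)` would contain `(u - 1) w`, which lies in `ker (u - 1)`
  obtain ⟨a, ha, h, hh, hha⟩ : ∃ a, u.val a = a ∧ ∃ h ∈ H, u.val (h.val a) ≠ h.val a := by
    by_contra! hc
    let L : Subrepresentation (tautRep H) :=
      ⟨LinearMap.ker (u.val - 1), fun g v hv ↦ by
        simp only [LinearMap.mem_ker, LinearMap.sub_apply, Module.End.one_apply,
          sub_eq_zero] at hv ⊢
        exact hc v hv g g.2⟩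
    obtain ⟨L', hL'⟩ := hH.exists_isCompl L
    have h1 : L'.toSubmodule ≤ L.toSubmodule := by
      intro w hw
      have h2 : (u.val - 1) w ∈ L'.toSubmodule :=
        sub_mem (L'.apply_mem_toSubmodule ⟨u, huH⟩ hw) hw
      have h3 : (u.val - 1) w ∈ L := congr($(sqz u hup) w)
      have h4 : (u.val - 1) w ∈ (⊥ : Subrepresentation (tautRep H)) := by
        rw [← hL'.inf_eq_bot]
        exact ⟨h3, h2⟩
      exact h4
    have h5 : L = ⊤ := by
      rw [eq_top_iff, ← hL'.sup_eq_top]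
      exact sup_le le_rfl h1
    refine hu1 ?_
    ext w
    have h6 : w ∈ L := h5 ▸ (Submodule.mem_top : w ∈ (⊤ : Submodule k V))
    exact sub_eq_zero.1 h6
  have ha0 : a ≠ 0 := by rintro rfl; simp at hha
  have hab : LinearIndependent k ![a, h.val a] := by
    rw [LinearIndependent.pair_iff' ha0]
    intro c hc
    rw [← hc, map_smul, ha] at hha
    exact hha rfl
  let v := h * u * h⁻¹
  have hvp : v ^ p = 1 := by rw [conj_pow, hup]; simp
  have hvb : v.val (h.val a) = h.val a := by
    change h.val (u.val (h⁻¹.val (h.val a))) = h.val a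
    rw [← Module.End.mul_apply h⁻¹.val, Units.inv_mul, Module.End.one_apply, ha]
  have hva : v.val a ≠ a := by
    intro hva
    have : v.val = 1 := end_ext_of_linearIndependent hV hab hva hvb
    have : v = 1 := Units.ext this
    rw [conj_eq_one_iff] at this
    exact hu1 congr(($this).val)
  have hGH : Subgroup.closure {u, v} ≤ H := by
    rw [Subgroup.closure_le]
    rintro _ (rfl | rfl)
    · exact huH
    · exact mul_mem (mul_mem hh huH) (inv_mem hh)
  refine hGH (neg_one_mem_of_even hV h2 ?_
    (even_card_of_transvections hV h2 _ rfl hup hvp (sqz u hup) (sqz v hvp) hab ha hvb hha hva))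
  have : Subgroup.closure {u, v} ≤
      (Units.map (LinearMap.det : Module.End k V →* k)).ker := by
    rw [Subgroup.closure_le]
    rintro _ (rfl | rfl)
    · exact Units.ext (hdet _ hup)
    · exact Units.ext (hdet _ hvp)
  exact fun g hg ↦ congrArg Units.val (this hg)

end Transvections

/-! ### Irreducible groups without scalars normalise a quadratic algebra -/

section Structure

variable {k V : Type*} [Field k] [AddCommGroup V] [Module k V]

/-- A Frobenius-Schur argument. If the commutant of `ρ` has no nonzero element of trace zero, every
average `∑ g, ρ g * X * ρ g⁻¹` is scalar, and its trace is known; hence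
`∑ g, tr (ρ g) * tr (ρ g⁻¹) = #G`. On the other hand the determinant condition gives
`tr (ρ g) * tr (ρ g⁻¹) = tr (ρ g) ^ 2 = tr (ρ (g ^ 2)) + 2`. As squaring is a bijection of the group
`G` of odd order and `∑ g, ρ g = 0`, the sum is also `2 * #G`. This avoids any extension of scalars
or character theory. -/
theorem exists_trace_eq_zero_commute_matrix {G : Type*} [Group G] [Fintype G] (h2 : (2 : k) ≠ 0)
    (ρ : G →* Matrix (Fin 2) (Fin 2) k) (hdet : ∀ g, (ρ g).det = 1) (hsum : ∑ g, ρ g = 0)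
    (hodd : Odd (Nat.card G)) (hcard : (Nat.card G : k) ≠ 0) :
    ∃ A : Matrix (Fin 2) (Fin 2) k, A.trace = 0 ∧ A ≠ 0 ∧ ∀ g, ρ g * A = A * ρ g := by
  by_contra! hA
  let T (X : Matrix (Fin 2) (Fin 2) k) : Matrix (Fin 2) (Fin 2) k := ∑ g, ρ g * X * ρ g⁻¹
  have hcomm (X) (h : G) : ρ h * T X = T X * ρ h := by
    simp only [T, Finset.mul_sum, Finset.sum_mul]
    rw [← (Group.mulLeft_bijective h).sum_comp (fun g ↦ ρ g * X * ρ g⁻¹ * ρ h)]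
    refine Finset.sum_congr rfl fun g _ ↦ ?_
    rw [mul_assoc _ _ (ρ h), ← map_mul, mul_inv_rev, inv_mul_cancel_right, map_mul]
    simp only [mul_assoc]
  have htr (X) : (T X).trace = Nat.card G * X.trace := by
    simp only [T, Matrix.trace_sum]
    rw [Finset.sum_congr rfl (g := fun _ ↦ X.trace), Finset.sum_const, Finset.card_univ,
      Nat.card_eq_fintype_card, nsmul_eq_mul]
    intro g _
    rw [Matrix.trace_mul_comm, ← mul_assoc, ← map_mul, inv_mul_cancel, map_one, one_mul]
  have hT (X) : T X = (Nat.card G * X.trace / 2 : k) • 1 := by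
    by_contra hne
    obtain ⟨g, hg⟩ := hA (T X - (Nat.card G * X.trace / 2 : k) • 1)
      (by rw [Matrix.trace_sub, htr, Matrix.trace_smul, Matrix.trace_one]; simp; field_simp; ring)
      (sub_ne_zero.2 hne)
    exact hg (by rw [mul_sub, sub_mul, hcomm]; simp)
  have hinv (g : G) : (ρ g⁻¹).trace = (ρ g).trace := by
    have : ρ g⁻¹ = (ρ g).adjugate := by
      rw [← one_mul (ρ g⁻¹), ← one_smul k 1, ← hdet g, ← Matrix.adjugate_mul, mul_assoc,
        ← map_mul]
      simp
    rw [this, Matrix.adjugate_fin_two, Matrix.trace_fin_two, Matrix.trace_fin_two]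
    simp [add_comm]
  have hsq (g : G) : (ρ g).trace * (ρ g⁻¹).trace = (ρ (g ^ 2)).trace + 2 := by
    have := hdet g
    rw [Matrix.det_fin_two] at this
    rw [hinv, map_pow, sq, Matrix.trace_fin_two, Matrix.trace_fin_two]
    simp only [Matrix.mul_apply, Fin.sum_univ_two]
    linear_combination 2 * this
  have h1 : ∑ g, (ρ g).trace * (ρ g⁻¹).trace = 2 * Nat.card G := by
    simp only [hsq, Finset.sum_add_distrib]
    have h3 : ∑ g, (ρ (g ^ 2)).trace = ∑ g, (ρ g).trace :=
      (powCoprime (G := G) (n := 2) (Nat.coprime_two_right.2 hodd)).sum_comp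
        (fun g ↦ (ρ g).trace)
    rw [h3, ← Matrix.trace_sum, hsum]
    simp [mul_comm]
  have h3 : ∑ g, (ρ g).trace * (ρ g⁻¹).trace =
      ∑ i, ∑ j, T (Matrix.single i j 1) i j := by
    simp only [T, Matrix.sum_apply, Matrix.trace_fin_two, Fin.sum_univ_two,
      ← Finset.sum_add_distrib]
    refine Finset.sum_congr rfl fun g _ ↦ ?_
    simp [Matrix.mul_apply, Matrix.single_apply]
    ring
  have h4 : ∑ i, ∑ j, T (Matrix.single i j 1) i j = Nat.card G := by
    simp only [hT]
    simp [Fin.sum_univ_two, Matrix.trace_fin_two, Matrix.single_apply]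
    field_simp
    ring
  rw [h1, h4] at h3
  exact hcard (by linear_combination h3)

theorem exists_trace_eq_zero_commute {G : Type*} [Group G] [Finite G] (h2 : (2 : k) ≠ 0)
    (hV : Module.finrank k V = 2) (ρ : G →* Module.End k V)
    (hdet : ∀ g, LinearMap.det (ρ g) = 1) (hfix : ∀ w, (∀ g, ρ g w = w) → w = 0)
    (hodd : Odd (Nat.card G)) (hcard : (Nat.card G : k) ≠ 0) :
    ∃ A : Module.End k V, LinearMap.trace k V A = 0 ∧ A ≠ 0 ∧ ∀ g, ρ g * A = A * ρ g := by
  have : Fintype G := Fintype.ofFinite G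
  have : Module.Finite k V := Module.finite_of_finrank_eq_succ hV
  let b := Module.finBasisOfFinrankEq k V hV
  let m := LinearMap.toMatrixAlgEquiv b
  have hsum : ∑ g, ρ g = 0 := by
    ext w
    refine hfix _ fun h ↦ ?_
    rw [← Module.End.mul_apply, Finset.mul_sum,
      ← (Group.mulLeft_bijective h).sum_comp (fun g ↦ ρ g)]
    simp
  obtain ⟨A, h1, h3, h4⟩ := exists_trace_eq_zero_commute_matrix h2
    ((m : Module.End k V →* Matrix (Fin 2) (Fin 2) k).comp ρ)
    (fun g ↦ (LinearMap.det_toMatrix b (ρ g)).trans (hdet g))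
    (by
      change ∑ g, m (ρ g) = 0
      rw [← map_sum, hsum, map_zero]) hodd hcard
  refine ⟨m.symm A, ?_, by simpa using h3, fun g ↦ m.injective ?_⟩
  · rw [LinearMap.trace_eq_matrix_trace k b, ← h1]
    exact congrArg _ (m.apply_symm_apply A)
  · rw [map_mul, map_mul, m.apply_symm_apply]
    exact h4 g

/-- `A` generates a quadratic étale subalgebra `k[A]` of `End_k(V)`, where `A ^ 2 = d ≠ 0`, such
that `A` is not scalar, and each element of `H` commutes or anticommutes with `A`. In particular
`H` normalises the torus `k[A]ˣ`; that `A` may be chosen of trace zero is no restriction in odd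
characteristic. -/
structure NormalizesQuadratic (H : Subgroup (GeneralLinearGroup k V)) (A : Module.End k V) (d : k) :
    Prop where
  ne_zero : d ≠ 0
  mul_self : A * A = d • 1
  ne_smul_one : ∀ c : k, A ≠ c • 1
  commute_or : ∀ h ∈ H, h.val * A = A * h.val ∨ h.val * A = -(A * h.val)

theorem eq_bot_or_eq_top_of_isIrreducible {H : Subgroup (GeneralLinearGroup k V)}
    (hH : (tautRep H).IsIrreducible) (L : Submodule k V)
    (hL : ∀ h ∈ H, ∀ v ∈ L, h.val v ∈ L) : L = ⊥ ∨ L = ⊤ := by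
  rcases hH.eq_bot_or_eq_top ⟨L, fun g v hv ↦ hL g g.2 v hv⟩ with h | h
  · exact .inl congr(($h).toSubmodule)
  · exact .inr congr(($h).toSubmodule)

theorem exists_ne_smul_one {H : Subgroup (GeneralLinearGroup k V)} (hV : Module.finrank k V = 2)
    (hH : (tautRep H).IsIrreducible) : ∃ h ∈ H, ∀ c : k, h.val ≠ c • 1 := by
  by_contra! hc
  have : Nontrivial V := Module.nontrivial_of_finrank_pos (R := k) (by omega)
  obtain ⟨v, hv⟩ := exists_ne (0 : V)
  rcases eq_bot_or_eq_top_of_isIrreducible hH (k ∙ v) (fun h hh w hw ↦ by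
    obtain ⟨c, hc⟩ := hc h hh
    rw [hc]
    exact Submodule.smul_mem _ _ hw) with h | h
  · exact hv (Submodule.span_singleton_eq_bot.1 h)
  · have := finrank_span_singleton (K := k) hv
    rw [h, finrank_top, hV] at this
    omega

/-- A non-scalar `A` commuting with an irreducible group does not have its eigenvalues in `k`. -/
theorem mul_self_ne_of_isIrreducible {H : Subgroup (GeneralLinearGroup k V)}
    (hH : (tautRep H).IsIrreducible) {A : Module.End k V} (hA : ∀ c : k, A ≠ c • 1)
    (hcomm : ∀ h ∈ H, h.val * A = A * h.val) (c : k) : A * A ≠ (c * c) • 1 := by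
  intro hsq
  rcases eq_bot_or_eq_top_of_isIrreducible hH (LinearMap.ker (A - c • 1)) (fun h hh v hv ↦ by
    rw [LinearMap.mem_ker, LinearMap.sub_apply, sub_eq_zero] at hv ⊢
    rw [← Module.End.mul_apply, ← hcomm h hh, Module.End.mul_apply, hv]
    simp) with h | h
  · refine hA (-c) ?_
    ext w
    have h1 : (A + c • 1) w ∈ LinearMap.ker (A - c • 1) := by
      have : (A - c • 1) * (A + c • 1) = 0 := by
        rw [sub_mul, mul_add, mul_add, hsq, smul_mul_smul_comm]
        simp only [mul_smul_comm, smul_mul_assoc, mul_one, one_mul]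
        abel
      exact congr($this w)
    rw [h] at h1
    have h3 : (A + c • 1) w = 0 := h1
    rw [LinearMap.add_apply, add_eq_zero_iff_eq_neg] at h3
    rw [h3]
    simp
  · exact hA c (sub_eq_zero.1 (LinearMap.ker_eq_top.1 h))

/-- A group of order prime to the characteristic has no unipotent elements other than `1`. -/
theorem eq_one_of_sub_one_mul_self {H : Subgroup (GeneralLinearGroup k V)}
    (hcard : (Nat.card H : k) ≠ 0)
    {g : GeneralLinearGroup k V} (hg : g ∈ H) (h : (g.val - 1) * (g.val - 1) = 0) : g = 1 := by
  have h1 (n : ℕ) : g.val ^ n = 1 + (n : k) • (g.val - 1) := by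
    induction n with
    | zero => simp
    | succ n ih =>
      have : g.val = 1 + (g.val - 1) := by abel
      rw [pow_succ, ih]
      nth_rw 2 [this]
      rw [add_mul, mul_add, mul_add, smul_mul_assoc, smul_mul_assoc, h]
      push_cast
      rw [add_smul]
      simp only [mul_one, one_mul, smul_zero, one_smul]
      abel
  have h3 : g ^ Nat.card H = 1 := by
    have : (⟨g, hg⟩ : H) ^ Nat.card H = 1 := pow_card_eq_one'
    exact congrArg Subtype.val this
  have h4 := h1 (Nat.card H)
  rw [← Units.val_pow_eq_pow_val, h3, Units.val_one, left_eq_add, smul_eq_zero, or_iff_right hcard,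
    sub_eq_zero] at h4
  exact Units.ext h4

/-- Let `N` be the subgroup of elements of determinant `1` of `H`, a group of odd order because
`-1 ∉ H`. If `N` is trivial, `H` is commutative and the trace zero part of a non-scalar element of
`H` will do. Otherwise an `A` of trace zero commuting with `N` exists by
`exists_trace_eq_zero_commute`; then `N ⊆ k[A]`, and since `H` normalises `N`, it normalises the
line spanned by `A`. -/
theorem exists_normalizesQuadratic [Finite k] (hV : Module.finrank k V = 2) (h2 : (2 : k) ≠ 0)
    {H : Subgroup (GeneralLinearGroup k V)} (hH : (tautRep H).IsIrreducible)
    (hcard : (Nat.card H : k) ≠ 0)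
    (hsc : ∀ h ∈ H, ∀ c : k, h.val = c • 1 → h = 1) :
    ∃ A d, NormalizesQuadratic H A d := by
  have : Module.Finite k V := Module.finite_of_finrank_eq_succ hV
  have : Finite V := Module.finite_of_finite k
  have : Finite (Module.End k V) := Finite.of_injective _ DFunLike.coe_injective
  have : Nontrivial V := Module.nontrivial_of_finrank_pos (R := k) (by omega)
  have hneg : -1 ∉ H := fun h ↦ neg_one_ne_one h2 (hsc _ h (-1) (by simp))
  have key (A : Module.End k V) (htr : LinearMap.trace k V A = 0) :
      A * A = (-LinearMap.det A) • 1 := by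
    rw [mul_self_eq_of_finrank_eq_two hV, htr]; simp
  have nonsc (A : Module.End k V) (htr : LinearMap.trace k V A = 0) (h0 : A ≠ 0) (c : k) :
      A ≠ c • 1 := by
    rintro rfl
    rw [map_smul, trace_one_of_finrank_eq_two hV, smul_eq_mul, mul_eq_zero, or_iff_left h2] at htr
    simp [htr] at h0
  let N : Subgroup (GeneralLinearGroup k V) :=
    H ⊓ (Units.map (LinearMap.det : Module.End k V →* k)).ker
  have hNH : N ≤ H := inf_le_left
  have hNdet (g) (hg : g ∈ N) : LinearMap.det g.val = 1 := congrArg Units.val hg.2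
  have hNcard : (Nat.card N : k) ≠ 0 := by
    obtain ⟨m, hm⟩ := Subgroup.card_dvd_of_le hNH
    intro h
    rw [hm, Nat.cast_mul, h, zero_mul] at hcard
    exact hcard rfl
  by_cases hN : ∃ g ∈ N, g ≠ 1
  · obtain ⟨g, hgN, hg1⟩ := hN
    have hodd : Odd (Nat.card N) := by
      rw [← Nat.not_even_iff_odd]
      exact fun h ↦ hneg (hNH (neg_one_mem_of_even hV h2 hNdet h))
    obtain ⟨A, htr, hA0, hAN⟩ := exists_trace_eq_zero_commute h2 hV
      ((Units.coeHom (Module.End k V)).comp N.subtype) (fun g ↦ hNdet g g.2) (fun w hw ↦ by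
        -- an element of determinant `1` fixing a nonzero vector is unipotent
        by_contra hw0
        have h1 : g.val w = w := hw ⟨g, hgN⟩
        have h3 := mul_self_eq_of_finrank_eq_two hV g.val
        rw [hNdet g hgN] at h3
        have h4 := congr($h3 w)
        simp only [Module.End.mul_apply, h1, LinearMap.sub_apply, LinearMap.smul_apply,
          Module.End.one_apply, one_smul] at h4
        have h5 : LinearMap.trace k V g.val = 2 := by
          have h6 : (LinearMap.trace k V g.val - 2) • w = 0 := by
            rw [sub_smul, two_smul]; nth_rw 2 [h4]; abel
          rw [smul_eq_zero, or_iff_left hw0, sub_eq_zero] at h6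
          exact h6
        refine hg1 (eq_one_of_sub_one_mul_self hcard (hNH hgN) ?_)
        rw [sub_mul, mul_sub, mul_sub, h3, h5]
        simp only [two_smul, one_smul, mul_one, one_mul]
        abel) hodd hNcard
    replace hAN (g) (hg : g ∈ N) : g.val * A = A * g.val := hAN ⟨g, hg⟩
    have hAs := nonsc A htr hA0
    -- if `A` is nilpotent, the square of an element of `N ⊆ k[A]` is unipotent
    have hd0 : -LinearMap.det A ≠ 0 := by
      intro hd
      have hAA := key A htr
      rw [hd, zero_smul] at hAA
      obtain ⟨a, b, hab⟩ := exists_eq_of_commute hV hAs (hAN g hgN)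
      have h1 : g ^ 2 = 1 := by
        have h3 : (g ^ 2).val = (a * a) • 1 + (2 * a * b) • A := by
          rw [sq, Units.val_mul, hab]
          simp only [add_mul, mul_add, smul_mul_smul_comm, hAA, one_mul, mul_one]
          module
        have h4 : a * a = 1 := by
          have h5 := mul_self_eq_of_finrank_eq_two hV g.val
          have h6 : LinearMap.trace k V g.val = 2 * a := by
            rw [hab, map_add, map_smul, map_smul, htr, trace_one_of_finrank_eq_two hV]
            simp [mul_comm]
          rw [hNdet g hgN, h6, ← Units.val_mul, ← sq, h3, hab] at h5
          have h7 : (1 - a * a) • (1 : Module.End k V) = 0 := by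
            rw [← sub_eq_zero.2 h5]
            module
          rw [smul_eq_zero, or_iff_left one_ne_zero, sub_eq_zero] at h7
          exact h7.symm
        refine eq_one_of_sub_one_mul_self hcard (pow_mem (hNH hgN) 2) ?_
        rw [h3, h4, one_smul, add_sub_cancel_left, smul_mul_smul_comm, hAA, smul_zero]
      have h3 := eq_neg_one_of_mul_self_eq_one hV h2 (A := g.val)
        (by rw [← Units.val_mul, ← sq, h1, Units.val_one]) (hNdet g hgN)
        (fun h ↦ hg1 (Units.ext h))
      have h4 : g = -1 := Units.ext h3
      exact hneg (h4 ▸ hNH hgN)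
    refine ⟨A, _, hd0, key A htr, hAs, fun h hh ↦ ?_⟩
    obtain ⟨a, b, hab⟩ := exists_eq_of_commute hV hAs (hAN g hgN)
    have hb : b ≠ 0 := by
      rintro rfl
      rw [zero_smul, add_zero] at hab
      exact hg1 (hsc g (hNH hgN) a hab)
    have hg'N : h * g * h⁻¹ ∈ N := by
      refine Subgroup.mem_inf.2 ⟨mul_mem (mul_mem hh (hNH hgN)) (inv_mem hh), ?_⟩
      have := (Subgroup.mem_inf.1 hgN).2
      rw [MonoidHom.mem_ker] at this ⊢
      rw [map_mul, map_mul, this, mul_one, ← map_mul, mul_inv_cancel, map_one]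
    obtain ⟨a', b', hab'⟩ := exists_eq_of_commute hV hAs (hAN _ hg'N)
    -- `h A h⁻¹` again lies in `k[A]`, has trace zero and the same square as `A`
    have h1 : h.val * g.val = (h * g * h⁻¹).val * h.val := by
      rw [← Units.val_mul, ← Units.val_mul, inv_mul_cancel_right]
    rw [hab', hab, mul_add, add_mul] at h1
    simp only [mul_smul_comm, smul_mul_assoc, mul_one, one_mul] at h1
    have h3 : h.val * A = (b⁻¹ * (a' - a)) • h.val + (b⁻¹ * b') • (A * h.val) := by
      rw [mul_smul, mul_smul, ← smul_add, ← inv_smul_eq_iff₀ (inv_ne_zero hb), inv_inv, sub_smul,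
        eq_sub_of_add_eq' h1]
      abel
    set c := b⁻¹ * (a' - a)
    set e := b⁻¹ * b'
    have h4 : h.val * A * h⁻¹.val = c • 1 + e • A := by
      rw [h3, add_mul, smul_mul_assoc, smul_mul_assoc, mul_assoc, Units.mul_inv, mul_one]
    have h5 : c = 0 := by
      have := congrArg (LinearMap.trace k V) h4
      rw [LinearMap.trace_mul_comm, ← mul_assoc, Units.inv_mul, one_mul, htr, map_add, map_smul,
        map_smul, htr, trace_one_of_finrank_eq_two hV] at this
      simpa [h2] using this
    rw [h5, zero_smul, zero_add] at h3
    rw [h5, zero_smul, zero_add] at h4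
    have h6 : e * e = 1 := by
      have h7 : h.val * A * h⁻¹.val * (h.val * A * h⁻¹.val) = (-LinearMap.det A) • 1 := by
        simp only [mul_assoc]
        rw [← mul_assoc h⁻¹.val, Units.inv_mul, one_mul, ← mul_assoc A A, key A htr,
          smul_mul_assoc, mul_smul_comm, one_mul, Units.mul_inv]
      rw [h4, smul_mul_smul_comm, key A htr, smul_smul] at h7
      have h8 := smul_left_injective k (one_ne_zero (α := Module.End k V)) h7
      exact mul_right_cancel₀ hd0 (h8.trans (one_mul _).symm)
    rcases mul_self_eq_one_iff.1 h6 with h9 | h9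
    · left; rw [h3, h9, one_smul]
    · right; rw [h3, h9, neg_one_smul]
  · push Not at hN
    have hcomm (g) (hg : g ∈ H) (h) (hh : h ∈ H) : g.val * h.val = h.val * g.val := by
      have : g * h * (h * g)⁻¹ ∈ N := by
        refine Subgroup.mem_inf.2 ⟨mul_mem (mul_mem hg hh) (inv_mem (mul_mem hh hg)), ?_⟩
        rw [MonoidHom.mem_ker, map_mul, map_inv, map_mul, map_mul, mul_comm (Units.map _ h),
          mul_inv_cancel]
      have := mul_inv_eq_one.1 (hN _ this)
      exact congrArg Units.val this
    obtain ⟨g, hg, hgs⟩ := exists_ne_smul_one hV hH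
    let A : Module.End k V := g.val - (LinearMap.trace k V g.val / 2) • 1
    have htr : LinearMap.trace k V A = 0 := by
      rw [map_sub, map_smul, trace_one_of_finrank_eq_two hV, smul_eq_mul, div_mul_cancel₀ _ h2,
        sub_self]
    have hA0 : A ≠ 0 := fun h ↦ hgs _ (sub_eq_zero.1 h)
    have hAs := nonsc A htr hA0
    have hAH (h) (hh : h ∈ H) : h.val * A = A * h.val := by
      rw [mul_sub, sub_mul, hcomm h hh g hg]
      simp
    refine ⟨A, _, fun h ↦ ?_, key A htr, hAs, fun h hh ↦ .inl (hAH h hh)⟩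
    exact mul_self_ne_of_isIrreducible hH hAs hAH 0 (by rw [key A htr, h, mul_zero])

end Structure

/-! ### The rotation subgroup -/

section Rotations

variable {k V : Type*} [Field k] [AddCommGroup V] [Module k V]

/-- The subgroup of the elements of `H` that commute with `A`. If `A` is as in
`NormalizesQuadratic`, it has index one or two in `H`, and becomes the rotation subgroup of a
dihedral group if the index is two. -/
def rotations (H : Subgroup (GeneralLinearGroup k V)) (A : Module.End k V) :
    Subgroup (GeneralLinearGroup k V) where
  carrier := {h | h ∈ H ∧ h.val * A = A * h.val}
  one_mem' := ⟨one_mem H, by simp⟩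
  mul_mem' {a b} ha hb := ⟨mul_mem ha.1 hb.1, by
    rw [Units.val_mul, mul_assoc, hb.2, ← mul_assoc, ha.2, mul_assoc]⟩
  inv_mem' {a} ha := ⟨inv_mem ha.1, by
    rw [Units.inv_mul_eq_iff_eq_mul, ← mul_assoc, ha.2, mul_assoc, Units.mul_inv, mul_one]⟩

theorem rotations_le (H : Subgroup (GeneralLinearGroup k V)) (A : Module.End k V) :
    rotations H A ≤ H :=
  fun _ h ↦ h.1

namespace NormalizesQuadratic

variable {H : Subgroup (GeneralLinearGroup k V)} {A : Module.End k V} {d : k}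

theorem trace_eq_zero (hA : NormalizesQuadratic H A d) (hV : Module.finrank k V = 2) :
    LinearMap.trace k V A = 0 := by
  by_contra ht
  have h := mul_self_eq_of_finrank_eq_two hV A
  rw [hA.mul_self, eq_sub_iff_add_eq, ← add_smul, eq_comm, ← eq_inv_smul_iff₀ ht, smul_smul] at h
  exact hA.ne_smul_one _ h

theorem mul_conj (hA : NormalizesQuadratic H A d) (a b : k) :
    (a • 1 + b • A) * (a • 1 - b • A) = (a ^ 2 - b ^ 2 * d) • 1 := by
  simp only [mul_sub, add_mul, smul_mul_smul_comm, mul_one, one_mul, hA.mul_self]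
  module

theorem det_add (hA : NormalizesQuadratic H A d) (hV : Module.finrank k V = 2) (a b : k) :
    LinearMap.det (a • 1 + b • A) = a ^ 2 - b ^ 2 * d := by
  have : Nontrivial V := Module.nontrivial_of_finrank_pos (R := k) (by omega)
  have h := mul_self_eq_of_finrank_eq_two hV (a • 1 + b • A)
  rw [map_add, map_smul, map_smul, hA.trace_eq_zero hV, trace_one_of_finrank_eq_two hV] at h
  simp only [mul_add, add_mul, smul_mul_smul_comm, mul_one, one_mul, hA.mul_self] at h
  have h1 : (LinearMap.det (a • 1 + b • A) - (a ^ 2 - b ^ 2 * d)) • (1 : Module.End k V) = 0 := by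
    rw [← sub_eq_zero.2 h, smul_eq_mul, smul_eq_mul]
    module
  rw [smul_eq_zero, or_iff_left one_ne_zero, sub_eq_zero] at h1
  exact h1

theorem smul_add_smul_inj (hA : NormalizesQuadratic H A d) {a b a' b' : k}
    (h : a • 1 + b • A = a' • 1 + b' • A) : a = a' ∧ b = b' := by
  have : Nontrivial (Module.End k V) := ⟨0, A, (by simpa using (hA.ne_smul_one 0).symm)⟩
  have h1 : (b - b') • A = (a' - a) • 1 := by
    rw [sub_smul, sub_smul, sub_eq_sub_iff_add_eq_add, add_comm, h]
  have hb : b - b' = 0 := by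
    by_contra hb
    rw [← eq_inv_smul_iff₀ hb, smul_smul] at h1
    exact hA.ne_smul_one _ h1
  rw [hb, zero_smul, eq_comm, smul_eq_zero, or_iff_left one_ne_zero, sub_eq_zero] at h1
  exact ⟨h1.symm, sub_eq_zero.1 hb⟩

theorem mul_self_eq_one_of_anticommute (hA : NormalizesQuadratic H A d)
    (hV : Module.finrank k V = 2) (h2 : (2 : k) ≠ 0)
    (hsc : ∀ h ∈ H, ∀ c : k, h.val = c • 1 → h = 1) {s : GeneralLinearGroup k V} (hs : s ∈ H)
    (hsA : s.val * A = -(A * s.val)) : s * s = 1 := by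
  have h1 := trace_eq_zero_of_anticommute h2 hA.ne_zero hA.mul_self hsA
  have h3 := mul_self_eq_of_finrank_eq_two hV s.val
  rw [h1, zero_smul, zero_sub, ← neg_smul] at h3
  exact hsc _ (mul_mem hs hs) _ h3

/-- Rotations have determinant `1`. If some `s ∈ H` anticommutes with `A`, this holds because `s`
and `s * t` are both involutions. Otherwise `A ^ 2` is not a square in `k`, and `t ^ (q + 1) = det
t` is a scalar in `H`, where `q` is the number of elements of `k`. -/
theorem exists_eq_of_mem_rotations [Finite k] (hA : NormalizesQuadratic H A d)
    (hV : Module.finrank k V = 2) (h2 : (2 : k) ≠ 0) (hH : (tautRep H).IsIrreducible)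
    (hsc : ∀ h ∈ H, ∀ c : k, h.val = c • 1 → h = 1) {t : GeneralLinearGroup k V}
    (ht : t ∈ rotations H A) :
    ∃ a b : k, t.val = a • 1 + b • A ∧ a ^ 2 - b ^ 2 * d = 1 := by
  have : Nontrivial V := Module.nontrivial_of_finrank_pos (R := k) (by omega)
  obtain ⟨a, b, hab⟩ := exists_eq_of_commute hV hA.ne_smul_one ht.2
  refine ⟨a, b, hab, ?_⟩
  have hone {c : k} (h : c • (1 : Module.End k V) = 1) : c = 1 :=
    smul_left_injective k (one_ne_zero (α := Module.End k V)) (h.trans (one_smul k 1).symm)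
  by_cases hs : ∃ s ∈ H, s.val * A ≠ A * s.val
  · obtain ⟨s, hs, hsA⟩ := hs
    replace hsA := (hA.commute_or s hs).resolve_left hsA
    have h1 := hA.mul_self_eq_one_of_anticommute hV h2 hsc hs hsA
    have h3 := hA.mul_self_eq_one_of_anticommute hV h2 hsc (s := s * t) (mul_mem hs ht.1) (by
      rw [Units.val_mul, mul_assoc, ht.2, ← mul_assoc, hsA, neg_mul, mul_assoc])
    have h4 : s.val * t.val = (a • 1 - b • A) * s.val := by
      rw [hab, mul_add, sub_mul, mul_smul_comm, mul_smul_comm, hsA, smul_neg, smul_mul_assoc,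
        smul_mul_assoc, mul_one, one_mul, sub_eq_add_neg]
    have h5 := congrArg Units.val h3
    rw [Units.val_mul, Units.val_mul, mul_assoc, ← mul_assoc t.val, mul_assoc t.val, h4,
      ← mul_assoc t.val, hab, hA.mul_conj, smul_mul_assoc, one_mul, mul_smul_comm,
      ← Units.val_mul, h1, Units.val_one] at h5
    exact hone h5
  · push Not at hs
    have hd (c : k) : d ≠ c * c := fun h ↦
      mul_self_ne_of_isIrreducible hH hA.ne_smul_one hs c (h ▸ hA.mul_self)
    have : Fintype k := Fintype.ofFinite k
    obtain ⟨p, hp⟩ := CharP.exists k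
    have hpp : Fact p.Prime := ⟨CharP.char_is_prime k p⟩
    have : ExpChar k p := .prime Fact.out
    have : CharP (Module.End k V) p := charP_of_injective_algebraMap' k p
    have : ExpChar (Module.End k V) p := .prime Fact.out
    obtain ⟨n, _, hn⟩ := FiniteField.card k p
    have hchar := ringChar_ne_two h2
    -- the `q`-th power map is the conjugation of `k[A]`
    have hA1 : A ^ Fintype.card k = -A := by
      have hodd := FiniteField.odd_card_of_char_ne_two hchar
      have h3 : Fintype.card k = 2 * (Fintype.card k / 2) + 1 := by
        exact (Nat.two_mul_div_two_add_one_of_odd (Nat.odd_iff.2 hodd)).symm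
      rw [h3, pow_succ, pow_mul, sq, hA.mul_self, smul_pow, one_pow,
        (FiniteField.pow_dichotomy hchar hA.ne_zero).resolve_left, neg_one_smul, neg_one_mul]
      intro h
      obtain ⟨c, hc⟩ := (FiniteField.isSquare_iff hchar hA.ne_zero).2 h
      exact hd c hc
    have h3 : t.val ^ Fintype.card k = a • 1 - b • A := by
      rw [hab, sub_eq_add_neg, ← smul_neg, ← hA1]
      nth_rw 1 [hn]
      rw [add_pow_expChar_pow_of_commute, ← hn, smul_pow, smul_pow, FiniteField.pow_card,
        FiniteField.pow_card, one_pow]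
      exact ((Commute.one_left A).smul_left a).smul_right b
    have h4 : (t ^ (Fintype.card k + 1)).val = (a ^ 2 - b ^ 2 * d) • 1 := by
      rw [pow_succ', Units.val_mul, Units.val_pow_eq_pow_val, h3, hab, hA.mul_conj]
    have h5 := hsc _ (pow_mem ht.1 _) _ h4
    rw [h5, Units.val_one] at h4
    exact hone h4.symm

/-- A square root `α` of `d` in an extension field yields an evaluation `a + b A ↦ a + b α`, which
is injective on the rotations since these have determinant `a ^ 2 - b ^ 2 * d = 1`. -/
theorem exists_char [Finite k] (hA : NormalizesQuadratic H A d)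
    (hV : Module.finrank k V = 2) (h2 : (2 : k) ≠ 0) (hH : (tautRep H).IsIrreducible)
    (hsc : ∀ h ∈ H, ∀ c : k, h.val = c • 1 → h = 1)
    {K : Type*} [Field K] [Algebra k K] {α : K} (hα : α * α = algebraMap k K d) :
    ∃ χ : rotations H A →* K, Function.Injective χ ∧
      ∀ t : rotations H A, ∃ a b : k, t.1.val = a • 1 + b • A ∧ a ^ 2 - b ^ 2 * d = 1 ∧
        χ t = algebraMap k K a + algebraMap k K b * α := by
  have key (t : rotations H A) := hA.exists_eq_of_mem_rotations hV h2 hH hsc t.2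
  choose a b hab hnorm using key
  have hα0 : α ≠ 0 := by
    rintro rfl
    rw [mul_zero, eq_comm, map_eq_zero] at hα
    exact hA.ne_zero hα
  let χ : rotations H A →* K :=
    { toFun t := algebraMap k K (a t) + algebraMap k K (b t) * α
      map_one' := by
        have h := hA.smul_add_smul_inj (a := a 1) (b := b 1) (a' := 1) (b' := 0) (by
          rw [← hab 1]; simp)
        simp [h.1, h.2]
      map_mul' x y := by
        have h := hA.smul_add_smul_inj (a := a (x * y)) (b := b (x * y))
          (a' := a x * a y + b x * b y * d) (b' := a x * b y + b x * a y) (by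
          rw [← hab, Subgroup.coe_mul, Units.val_mul, hab, hab]
          simp only [mul_add, add_mul, smul_mul_smul_comm, mul_one, one_mul, hA.mul_self]
          module)
        rw [h.1, h.2]
        simp only [map_add, map_mul]
        linear_combination (-(algebraMap k K (b x) * algebraMap k K (b y))) * hα }
  refine ⟨χ, ?_, fun t ↦ ⟨a t, b t, hab t, hnorm t, rfl⟩⟩
  rw [injective_iff_map_eq_one]
  intro t ht
  change algebraMap k K (a t) + algebraMap k K (b t) * α = 1 at ht
  have h1 := congrArg (algebraMap k K) (hnorm t)
  simp only [map_sub, map_mul, map_pow, map_one, ← hα] at h1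
  have h3 : algebraMap k K (a t) - algebraMap k K (b t) * α = 1 := by
    have h4 : (algebraMap k K (a t) + algebraMap k K (b t) * α) *
      (algebraMap k K (a t) - algebraMap k K (b t) * α) = 1 := by linear_combination h1
    rwa [ht, one_mul] at h4
  have h20 := two_ne_zero_of_algebra K h2
  have h5 : b t = 0 := by
    have : 2 * (algebraMap k K (b t) * α) = 0 := by linear_combination ht - h3
    simpa [h20, hα0] using this
  have h6 : a t = 1 := by
    rw [h5, map_zero, zero_mul, add_zero] at ht
    exact (algebraMap k K).injective (by rw [ht, map_one])
  refine Subtype.ext (Units.ext ?_)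
  rw [hab, h5, h6]
  simp

theorem odd_card_rotations [Finite k] (hA : NormalizesQuadratic H A d)
    (hV : Module.finrank k V = 2) (h2 : (2 : k) ≠ 0) (hH : (tautRep H).IsIrreducible)
    (hsc : ∀ h ∈ H, ∀ c : k, h.val = c • 1 → h = 1) [Finite (rotations H A)] :
    Odd (Nat.card (rotations H A)) := by
  have : Nontrivial V := Module.nontrivial_of_finrank_pos (R := k) (by omega)
  rw [← Nat.not_even_iff_odd]
  intro h
  have h1 := neg_one_mem_of_even hV h2 (fun g hg ↦ by
    obtain ⟨a, b, hab, h⟩ := hA.exists_eq_of_mem_rotations hV h2 hH hsc hg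
    rw [hab, hA.det_add hV, h]) h
  exact neg_one_ne_one h2 (hsc _ h1.1 (-1) (by simp))

/-- If there were no nontrivial rotation, all elements of `H` but `1` would anticommute with `A`,
and `H` would have at most two elements. -/
theorem one_lt_card_rotations (hA : NormalizesQuadratic H A d)
    (hV : Module.finrank k V = 2) (h2 : (2 : k) ≠ 0) (hH : (tautRep H).IsIrreducible)
    (hsc : ∀ h ∈ H, ∀ c : k, h.val = c • 1 → h = 1) [Finite (rotations H A)] :
    1 < Nat.card (rotations H A) := by
  rw [Finite.one_lt_card_iff_nontrivial]
  by_contra hn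
  rw [not_nontrivial_iff_subsingleton] at hn
  replace hn := (Subgroup.eq_bot_iff_forall _).1 (Subgroup.eq_bot_of_subsingleton (rotations H A))
  obtain ⟨s, hs, hs'⟩ := exists_ne_smul_one hV hH
  have anti (h : GeneralLinearGroup k V) (hh : h ∈ H) (h1 : h ≠ 1) : h.val * A = -(A * h.val) :=
    (hA.commute_or h hh).resolve_left fun h3 ↦ h1 (hn h ⟨hh, h3⟩)
  have hs1 : s ≠ 1 := by rintro rfl; exact hs' 1 (by simp)
  have hss := hA.mul_self_eq_one_of_anticommute hV h2 hsc hs (anti s hs hs1)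
  refine mul_self_ne_of_isIrreducible hH hs' (fun h hh ↦ ?_) 1
    (by rw [← Units.val_mul, hss]; simp)
  by_cases h1 : h = 1
  · simp [h1]
  have h3 := hn (s * h) ⟨mul_mem hs hh, by
    rw [Units.val_mul, mul_assoc, anti h hh h1, mul_neg, ← mul_assoc, anti s hs hs1, neg_mul,
      neg_neg, mul_assoc]⟩
  rw [show h = s from mul_left_cancel (h3.trans hss.symm)]

end NormalizesQuadratic
end Rotations

/-! ### Dihedral groups and induced representations -/

section Forms

variable {k V : Type*} [Field k] [AddCommGroup V] [Module k V]

/-- The homomorphism from the dihedral group given by a homomorphism `c` on the rotations and an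
involution `s` which inverts the image of `c`, with `r i ↦ c i` and `sr i ↦ s * c i`. -/
def dihedralHom {G : Type*} [Monoid G] {n : ℕ} (c : Cyc n →* G) (s : G) (hs : s * s = 1)
    (hc : ∀ a, c a * s = s * c a⁻¹) : DihedralGroup n →* G where
  toFun
    | .r i => c (.ofAdd i)
    | .sr i => s * c (.ofAdd i)
  map_one' := c.map_one
  map_mul' x y := by
    rcases x with i | i <;> rcases y with j | j
    · exact c.map_mul _ _
    · change s * c (.ofAdd (j - i)) = c (.ofAdd i) * (s * c _)
      rw [← mul_assoc, hc, mul_assoc, ← map_mul, ← ofAdd_neg, ← ofAdd_add, neg_add_eq_sub]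
    · change s * c (.ofAdd (i + j)) = s * c _ * c _
      rw [mul_assoc, ← map_mul, ← ofAdd_add]
    · change c (.ofAdd (j - i)) = s * c (.ofAdd i) * (s * c (.ofAdd j))
      rw [mul_assoc, ← mul_assoc (c _), hc, mul_assoc, ← mul_assoc s, hs, one_mul, ← map_mul,
        ← ofAdd_neg, ← ofAdd_add, neg_add_eq_sub]

section Induced

variable {n : ℕ}

theorem indMk_rot_mul (ψ : Cyc n →* kˣ) (a : Cyc n) (h : DihedralGroup n) :
    Representation.IndV.mk (rot n) (charRep ψ) (rot n a * h) 1 =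
      ((ψ a)⁻¹ : kˣ).val • Representation.IndV.mk (rot n) (charRep ψ) h 1 := by
  have h1 := Representation.Coinvariants.mk_self_apply
    (Representation.tprod ((Representation.leftRegular k (DihedralGroup n)).comp (rot n))
      (charRep ψ)) a (TensorProduct.tmul k (MonoidAlgebra.single h 1) 1)
  have h3 : Representation.IndV.mk (rot n) (charRep ψ) (rot n a * h) (ψ a : k) =
      Representation.IndV.mk (rot n) (charRep ψ) h 1 := by
    simpa [charRep, Representation.leftRegular, Representation.ofMulAction_single] using! h1
  rw [← h3, ← map_smul]
  simp

/-- The map from the induced representation given by Frobenius reciprocity and an eigenvector `v` of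
the rotations. The class of `single h 1 ⊗ 1` goes to `h⁻¹ v`, the group acting by right translation
by the inverse on the left factor. -/
def indLift (ψ : Cyc n →* kˣ) {U : Type*} [AddCommGroup U] [Module k U]
    (σ : Representation k (DihedralGroup n) U) {v : U}
    (hv : ∀ a, σ (rot n a) v = (ψ a : k) • v) :
    Representation.IndV (rot n) (charRep ψ) →ₗ[k] U :=
  Representation.Coinvariants.lift _
    (TensorProduct.lift <|
      (Finsupp.lift _ _ _ fun h => σ h⁻¹ ∘ₗ LinearMap.toSpanSingleton k U v) ∘ₗ
      (MonoidAlgebra.coeffLinearEquiv k).toLinearMap)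
    fun g ↦ by
      ext h
      have h1 : σ (rot n g)⁻¹ v = ((ψ g)⁻¹ : kˣ).val • v := by
        rw [← map_inv, hv, map_inv]
      simp [charRep, Representation.leftRegular, Representation.ofMulAction_single, h1, smul_smul]

theorem indLift_mk (ψ : Cyc n →* kˣ) {U : Type*} [AddCommGroup U] [Module k U]
    (σ : Representation k (DihedralGroup n) U) {v : U}
    (hv : ∀ a, σ (rot n a) v = (ψ a : k) • v) (h : DihedralGroup n) :
    indLift ψ σ hv (Representation.IndV.mk _ _ h 1) = σ h⁻¹ v := by
  simp [indLift]

/-- A plane with an eigenvector `v` of the rotations for the character `ψ`, such that `v` and `s v`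
are linearly independent, is isomorphic to `I(ψ)`. -/
theorem nonempty_repI_equiv (ψ : Cyc n →* kˣ) {U : Type*} [AddCommGroup U] [Module k U]
    (σ : Representation k (DihedralGroup n) U) (hU : Module.finrank k U = 2) {v : U}
    (hv : ∀ a, σ (rot n a) v = (ψ a : k) • v)
    (hli : LinearIndependent k ![v, σ (.sr 0) v]) : Nonempty ((repI ψ).Equiv σ) := by
  let B := basisOfLinearIndependentOfCardEqFinrank hli (by simp [hU])
  have hB0 : B 0 = v := by simp [B]
  have hB1 : B 1 = σ (.sr 0) v := by simp [B]
  let g : U →ₗ[k] Representation.IndV (rot n) (charRep ψ) :=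
    B.constr k ![Representation.IndV.mk _ _ 1 1, Representation.IndV.mk _ _ (.sr 0) 1]
  have hg0 : g v = Representation.IndV.mk _ _ 1 1 := by
    rw [← hB0, Module.Basis.constr_basis]; simp
  have hg1 : g (σ (.sr 0) v) = Representation.IndV.mk _ _ (.sr 0) 1 := by
    rw [← hB1, Module.Basis.constr_basis]; simp
  have hs : (DihedralGroup.sr 0 : DihedralGroup n)⁻¹ = .sr 0 := rfl
  let f := indLift ψ σ hv
  have hfg : f ∘ₗ g = LinearMap.id := by
    refine end_ext_of_linearIndependent hU hli ?_ ?_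
    · rw [LinearMap.comp_apply, hg0, indLift_mk]; simp
    · rw [LinearMap.comp_apply, hg1, indLift_mk, hs]; rfl
  have hvi (a : Cyc n) : σ (rot n a)⁻¹ v = ((ψ a)⁻¹ : kˣ).val • v := by
    rw [← map_inv, hv, map_inv]
  have hgf : g ∘ₗ f = LinearMap.id := by
    refine Representation.IndV.hom_ext _ _ fun h ↦ LinearMap.ext_ring ?_
    rw [LinearMap.comp_apply, LinearMap.comp_apply, indLift_mk, LinearMap.id_comp]
    rcases h with i | i
    · have h1 : DihedralGroup.r i = rot n (.ofAdd i) * 1 := (mul_one _).symm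
      rw [h1, indMk_rot_mul, mul_one, hvi, map_smul, hg0]
    · have h1 : DihedralGroup.sr i = rot n (.ofAdd (-i)) * .sr 0 := by
        change _ = DihedralGroup.sr (0 - -i)
        simp
      rw [h1, indMk_rot_mul, mul_inv_rev, hs, map_mul, Module.End.mul_apply, hvi, map_smul,
        map_smul, hg1]
  refine ⟨.mk (LinearEquiv.ofLinearMap f g hfg hgf) fun h ↦ ?_⟩
  refine Representation.IndV.hom_ext _ _ fun h' ↦ LinearMap.ext_ring ?_
  change f (Representation.ind _ _ h (Representation.IndV.mk _ _ h' 1)) =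
    σ h (f (Representation.IndV.mk _ _ h' 1))
  rw [Representation.ind_mk, indLift_mk, indLift_mk, mul_inv_rev, inv_inv, map_mul,
    Module.End.mul_apply]

end Induced
end Forms

/-! ### Recognising the representations `I(ψ)` and `J(ψ')` -/

section Classification

variable {k V : Type*} [Field k] [AddCommGroup V] [Module k V]

namespace NormalizesQuadratic

variable {H : Subgroup (GeneralLinearGroup k V)} {A : Module.End k V} {d : k} {n : ℕ}
  {k₂ : Type*} [Field k₂] [Algebra k k₂]

/-- If `d` is not a square, `V` is a line over `k₂ ≅ k[A]`. -/
theorem exists_equiv_quadratic (hA : NormalizesQuadratic H A d) (hV : Module.finrank k V = 2)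
    (h₂ : Module.finrank k k₂ = 2) (hd : ∀ c, d ≠ c * c) {α : k₂} (hα : α * α = algebraMap k k₂ d)
    {v : V} (hv : v ≠ 0) :
    ∃ e : k₂ ≃ₗ[k] V, e 1 = v ∧ ∀ x, e (α * x) = A (e x) := by
  have hli : LinearIndependent k ![v, A v] := by
    rw [LinearIndependent.pair_iff' hv]
    intro c hc
    have h1 : (A * A) v = (c * c) • v := by
      rw [Module.End.mul_apply, ← hc, map_smul, ← hc, smul_smul]
    rw [hA.mul_self, LinearMap.smul_apply, Module.End.one_apply] at h1
    exact hd c (smul_left_injective k hv h1)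
  have hli' := linearIndependent_one_of_mul_self hd hα
  let B := basisOfLinearIndependentOfCardEqFinrank hli (by simp [hV])
  let B' := basisOfLinearIndependentOfCardEqFinrank hli' (by simp [h₂])
  let e := B'.equiv B (Equiv.refl _)
  have h0 : e 1 = v := by
    have := B'.equiv_apply 0 B (Equiv.refl _)
    simpa [B, B'] using this
  have h1 : e α = A v := by
    have := B'.equiv_apply 1 B (Equiv.refl _)
    simpa [B, B'] using this
  refine ⟨e, h0, fun x ↦ ?_⟩
  obtain ⟨a, b, rfl⟩ := exists_eq_smul_add_smul h₂ hli' x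
  have h3 : A (A v) = d • v := congr($(hA.mul_self) v)
  rw [mul_add, mul_smul_comm, mul_smul_comm, mul_one, hα, Algebra.algebraMap_eq_smul_one]
  simp only [map_add, map_smul, h0, h1, h3]

theorem equiv_mul_apply {e : k₂ ≃ₗ[k] V} {α : k₂} (he : ∀ x, e (α * x) = A (e x)) (a b : k)
    (x : k₂) : e ((algebraMap k k₂ a + algebraMap k k₂ b * α) * x) = (a • 1 + b • A) (e x) := by
  rw [add_mul, mul_assoc, ← Algebra.smul_def, ← Algebra.smul_def, map_add, map_smul, map_smul, he]
  rfl

theorem equiv_conj_apply [Finite k] (h2 : (2 : k) ≠ 0)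
    (h₂ : Module.finrank k k₂ = 2) (hd : ∀ c, d ≠ c * c) {α : k₂} (hα : α * α = algebraMap k k₂ d)
    {e : k₂ ≃ₗ[k] V} (he : ∀ x, e (α * x) = A (e x)) {s : Module.End k V} (hs : s (e 1) = e 1)
    (hsA : s * A = -(A * s)) (x : k₂) : e (conj k k₂ x) = s (e x) := by
  obtain ⟨a, b, rfl⟩ := exists_eq_smul_add_smul h₂ (linearIndependent_one_of_mul_self hd hα) x
  have h1 : conj k k₂ 1 = 1 := by rw [conj_apply, one_pow]
  have h3 : e α = A (e 1) := by rw [← he, mul_one]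
  have h4 : s (A (e 1)) = -A (s (e 1)) := congr($hsA (e 1))
  simp only [map_add, map_smul, conj_eq_neg_of_mul_self h2 hd hα, h1, map_neg, hs, h3, h4]

/-- Both `s` and `s * t` are involutions, so that `s` inverts the rotation `t`. -/
theorem mul_eq_mul_inv (hA : NormalizesQuadratic H A d)
    (hV : Module.finrank k V = 2) (h2 : (2 : k) ≠ 0)
    (hsc : ∀ h ∈ H, ∀ c : k, h.val = c • 1 → h = 1) {s : GeneralLinearGroup k V} (hs : s ∈ H)
    (hsA : s.val * A = -(A * s.val)) {t : GeneralLinearGroup k V} (ht : t ∈ rotations H A) :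
    t * s = s * t⁻¹ := by
  have h1 := hA.mul_self_eq_one_of_anticommute hV h2 hsc hs hsA
  have h3 := hA.mul_self_eq_one_of_anticommute hV h2 hsc (s := s * t) (mul_mem hs ht.1) (by
    rw [Units.val_mul, mul_assoc, ht.2, ← mul_assoc, hsA, neg_mul, mul_assoc])
  rw [eq_mul_inv_iff_mul_eq, ← mul_left_cancel_iff (a := s), h1]
  simpa [mul_assoc] using h3

/-- If some `s ∈ H` anticommutes with `A`, then `H` is the dihedral group generated by `s` and the
cyclic group of rotations. -/
def dihedralEquiv (hA : NormalizesQuadratic H A d)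
    (hV : Module.finrank k V = 2) (h2 : (2 : k) ≠ 0)
    (hsc : ∀ h ∈ H, ∀ c : k, h.val = c • 1 → h = 1) {s : GeneralLinearGroup k V} (hs : s ∈ H)
    (hsA : s.val * A = -(A * s.val)) (c : Cyc n ≃* rotations H A) : DihedralGroup n ≃* H :=
  have hss := hA.mul_self_eq_one_of_anticommute hV h2 hsc hs hsA
  MulEquiv.ofBijective (dihedralHom ((Subgroup.inclusion (rotations_le H A)).comp c.toMonoidHom)
    ⟨s, hs⟩ (Subtype.ext hss)
    (fun a ↦ Subtype.ext (by
      have := hA.mul_eq_mul_inv hV h2 hsc hs hsA (c a).2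
      simpa using this))) (by
    have hsR : s ∉ rotations H A := by
      intro h
      have h3 := h.2
      rw [hsA, neg_eq_iff_add_eq_zero, ← two_smul k, smul_eq_zero, or_iff_right h2] at h3
      have h4 : A = (0 : k) • 1 := by
        have : A * s.val * s⁻¹.val = 0 := by rw [h3, zero_mul]
        rw [mul_assoc, Units.mul_inv, mul_one] at this
        simpa using this
      exact hA.ne_smul_one _ h4
    constructor
    · rw [injective_iff_map_eq_one]
      rintro (i | i) h
      · have h1 : ((c (.ofAdd i)) : GeneralLinearGroup k V) = 1 := congrArg Subtype.val h
        have h3 : c (.ofAdd i) = 1 := Subtype.ext h1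
        rw [map_eq_one_iff _ c.injective] at h3
        exact congrArg DihedralGroup.r h3
      · have h1 : s * ((c (.ofAdd i)) : GeneralLinearGroup k V) = 1 := congrArg Subtype.val h
        rw [mul_eq_one_iff_eq_inv] at h1
        exact absurd (h1 ▸ inv_mem (c (.ofAdd i)).2) hsR
    · rintro ⟨h, hh⟩
      rcases hA.commute_or h hh with h1 | h1
      · refine ⟨.r (c.symm ⟨h, hh, h1⟩).toAdd, Subtype.ext ?_⟩
        change (c (c.symm ⟨h, hh, h1⟩) : GeneralLinearGroup k V) = h
        simp
      · have h3 : s * h ∈ rotations H A := ⟨mul_mem hs hh, by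
          rw [Units.val_mul, mul_assoc, h1, mul_neg, ← mul_assoc, hsA, neg_mul, neg_neg,
            mul_assoc]⟩
        refine ⟨.sr (c.symm ⟨_, h3⟩).toAdd, Subtype.ext ?_⟩
        change s * (c (c.symm ⟨_, h3⟩) : GeneralLinearGroup k V) = h
        rw [MulEquiv.apply_symm_apply, ← mul_assoc, hss, one_mul])

theorem exists_normOne_char [Finite k] (h2 : (2 : k) ≠ 0)
    (h₂ : Module.finrank k k₂ = 2) (hd : ∀ c, d ≠ c * c) {α : k₂} (hα : α * α = algebraMap k k₂ d)
    (c : Cyc n ≃* rotations H A) {χ : rotations H A →* k₂}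
    (hχ : ∀ t : rotations H A, ∃ a b : k, t.1.val = a • 1 + b • A ∧ a ^ 2 - b ^ 2 * d = 1 ∧
        χ t = algebraMap k k₂ a + algebraMap k k₂ b * α) :
    ∃ ψ' : Cyc n →* normOne k k₂, ∀ a, ((ψ' a : k₂ˣ) : k₂) = χ (c a) := by
  refine ⟨(χ.comp c.toMonoidHom).toHomUnits.codRestrict _ fun a ↦ ?_, fun a ↦ rfl⟩
  refine Units.ext ?_
  change Algebra.norm k (χ (c a)) = 1
  obtain ⟨x, y, -, h1, h⟩ := hχ (c a)
  rw [norm_eq_one_iff h₂, h, conj_algebraMap_add_mul h2 hd hα]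
  have h3 := congrArg (algebraMap k k₂) h1
  simp only [map_sub, map_mul, map_pow, map_one, ← hα] at h3
  linear_combination h3

theorem exists_isOfForm_repJ_rot [Finite k] (hA : NormalizesQuadratic H A d)
    (hV : Module.finrank k V = 2) (h2 : (2 : k) ≠ 0)
    (h₂ : Module.finrank k k₂ = 2) (hd : ∀ c, d ≠ c * c) {α : k₂} (hα : α * α = algebraMap k k₂ d)
    (c : Cyc n ≃* rotations H A) {χ : rotations H A →* k₂}
    (hχ : ∀ t : rotations H A, ∃ a b : k, t.1.val = a • 1 + b • A ∧ a ^ 2 - b ^ 2 * d = 1 ∧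
        χ t = algebraMap k k₂ a + algebraMap k k₂ b * α)
    (hcomm : ∀ h ∈ H, h.val * A = A * h.val) :
    ∃ ψ' : Cyc n →* normOne k k₂, IsOfForm H ((repJ h₂ ψ').comp (rot n)) := by
  have : Nontrivial V := Module.nontrivial_of_finrank_pos (R := k) (by omega)
  obtain ⟨v, hv⟩ := exists_ne (0 : V)
  obtain ⟨ψ', hψ'⟩ := exists_normOne_char h2 h₂ hd hα c hχ
  obtain ⟨e, he1, he⟩ := hA.exists_equiv_quadratic hV h₂ hd hα hv
  have hR : rotations H A = H := le_antisymm (rotations_le H A) fun h hh ↦ ⟨hh, hcomm h hh⟩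
  refine ⟨ψ', c.trans (MulEquiv.subgroupCongr hR), ⟨.mk e fun g ↦ ?_⟩⟩
  ext x
  change e (((ψ' g : k₂ˣ) : k₂) * x) = (c g).1.val (e x)
  obtain ⟨a, b, hab, -, h⟩ := hχ (c g)
  rw [hψ', h, equiv_mul_apply he, hab]

theorem exists_isOfForm_repJ [Finite k] (hA : NormalizesQuadratic H A d)
    (hV : Module.finrank k V = 2) (h2 : (2 : k) ≠ 0)
    (hsc : ∀ h ∈ H, ∀ c : k, h.val = c • 1 → h = 1)
    (h₂ : Module.finrank k k₂ = 2) (hd : ∀ c, d ≠ c * c) {α : k₂} (hα : α * α = algebraMap k k₂ d)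
    (c : Cyc n ≃* rotations H A) {χ : rotations H A →* k₂}
    (hχ : ∀ t : rotations H A, ∃ a b : k, t.1.val = a • 1 + b • A ∧ a ^ 2 - b ^ 2 * d = 1 ∧
        χ t = algebraMap k k₂ a + algebraMap k k₂ b * α)
    {s : GeneralLinearGroup k V} (hs : s ∈ H) (hsA : s.val * A = -(A * s.val)) :
    ∃ ψ' : Cyc n →* normOne k k₂, IsOfForm H (repJ h₂ ψ') := by
  have hss := hA.mul_self_eq_one_of_anticommute hV h2 hsc hs hsA
  have hs1 : s.val ≠ -1 := fun h ↦ by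
    rw [h, neg_one_mul, mul_neg_one, neg_neg, neg_eq_iff_add_eq_zero, ← two_smul k, smul_eq_zero,
      or_iff_right h2] at hsA
    exact hA.ne_smul_one 0 (by simpa using hsA)
  obtain ⟨w, hw⟩ : ∃ w, w + s.val w ≠ 0 := by
    by_contra! h
    exact hs1 (LinearMap.ext fun w ↦ (neg_eq_of_add_eq_zero_right (h w)).symm)
  -- an `s`-fixed vector, to be identified with `1 ∈ k₂`
  have hsw : s.val (w + s.val w) = w + s.val w := by
    have : s.val (s.val w) = w := congr(($hss).val w)
    rw [map_add, this, add_comm]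
  obtain ⟨ψ', hψ'⟩ := exists_normOne_char h2 h₂ hd hα c hχ
  obtain ⟨e, he1, he⟩ := hA.exists_equiv_quadratic hV h₂ hd hα hw
  have hrot (g : Cyc n) (x : k₂) : e (((ψ' g : k₂ˣ) : k₂) * x) = (c g).1.val (e x) := by
    obtain ⟨a, b, hab, -, h⟩ := hχ (c g)
    rw [hψ', h, equiv_mul_apply he, hab]
  refine ⟨ψ', hA.dihedralEquiv hV h2 hsc hs hsA c, ⟨.mk e fun g ↦ ?_⟩⟩
  ext x
  rcases g with i | i
  · exact hrot (.ofAdd i) x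
  · change e (conj k k₂ (((ψ' (.ofAdd i) : k₂ˣ) : k₂) * x)) = s.val ((c (.ofAdd i)).1.val (e x))
    rw [equiv_conj_apply h2 h₂ hd hα he (by rw [he1, hsw]) hsA, hrot]

theorem exists_isOfForm_repI (hA : NormalizesQuadratic H A d)
    (hV : Module.finrank k V = 2) (h2 : (2 : k) ≠ 0)
    (hsc : ∀ h ∈ H, ∀ c : k, h.val = c • 1 → h = 1) {α : k} (hα : α * α = d)
    (c : Cyc n ≃* rotations H A) {χ : rotations H A →* k}
    (hχ : ∀ t : rotations H A, ∃ a b : k, t.1.val = a • 1 + b • A ∧ a ^ 2 - b ^ 2 * d = 1 ∧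
        χ t = a + b * α)
    {s : GeneralLinearGroup k V} (hs : s ∈ H) (hsA : s.val * A = -(A * s.val)) :
    ∃ ψ : Cyc n →* kˣ, IsOfForm H (repI ψ) := by
  have hss := hA.mul_self_eq_one_of_anticommute hV h2 hsc hs hsA
  have hα0 : α ≠ 0 := by
    rintro rfl
    exact hA.ne_zero (by rw [← hα, mul_zero])
  -- an eigenvector of `A` for the eigenvalue `α`
  obtain ⟨w, hw⟩ : ∃ w, A w + α • w ≠ 0 := by
    by_contra! h
    refine hA.ne_smul_one (-α) (LinearMap.ext fun w ↦ ?_)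
    simpa using eq_neg_of_add_eq_zero_left (h w)
  set v := A w + α • w
  have hAv : A v = α • v := by
    have : A (A w) = (α * α) • w := hα ▸ congr($(hA.mul_self) w)
    simp only [v, map_add, map_smul, this, smul_add, smul_smul]
    abel
  have hAsv : A (s.val v) = -(α • s.val v) := by
    have h1 : s.val (A v) = -A (s.val v) := congr($hsA v)
    rw [hAv, map_smul] at h1
    rw [h1, neg_neg]
  have hli : LinearIndependent k ![v, s.val v] := by
    rw [LinearIndependent.pair_iff' hw]
    intro b hb
    have hb0 : b • v ≠ 0 := by
      rw [hb]
      intro h0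
      refine hw ?_
      have : s.val (s.val v) = v := congr(($hss).val v)
      rw [← this, h0, map_zero]
    rw [← hb, map_smul, hAv, smul_comm, ← add_eq_zero_iff_eq_neg, ← two_smul k, smul_eq_zero,
      or_iff_right h2, smul_eq_zero, or_iff_right hα0] at hAsv
    exact hb0 hAsv
  let ψ : Cyc n →* kˣ := (χ.comp c.toMonoidHom).toHomUnits
  obtain ⟨E⟩ := nonempty_repI_equiv ψ
    ((tautRep H).comp (hA.dihedralEquiv hV h2 hsc hs hsA c).toMonoidHom) hV (v := v) (fun g ↦ by
      change (c g).1.val v = χ (c g) • v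
      obtain ⟨a, b, hab, -, h⟩ := hχ (c g)
      rw [hab, h]
      simp [hAv, add_smul, mul_smul]) (by
      have h1 : (tautRep H) (hA.dihedralEquiv hV h2 hsc hs hsA c (.sr 0)) v = s.val v := by
        change s.val ((c 1).1.val v) = s.val v
        simp
      exact h1.symm ▸ hli)
  exact ⟨ψ, hA.dihedralEquiv hV h2 hsc hs hsA c, ⟨E⟩⟩

end NormalizesQuadratic
end Classification

/-! ### Intertwining maps and the Frobenius -/

section Arithmetic
open Polynomial

/-- Over a finite prime field, conjugate elements differ by a power of the Frobenius. -/
theorem exists_eq_pow_of_aeval_minpoly {p : ℕ} [Fact p.Prime] {K : Type*} [Field K] [Finite K]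
    [Algebra (ZMod p) K] {x y : K} (h : aeval x (minpoly (ZMod p) y) = 0) :
    ∃ i : ℕ, x = y ^ p ^ i := by
  have : Module.Finite (ZMod p) K := Module.Finite.of_finite
  obtain ⟨σ, rfl⟩ := minpoly.exists_algEquiv_of_root' (Algebra.IsAlgebraic.isAlgebraic y) h
  obtain ⟨i, rfl⟩ := (FiniteField.bijective_frobeniusAlgEquivOfAlgebraic_pow (ZMod p) K).2 σ
  refine ⟨i, ?_⟩
  simp only [AlgEquiv.coe_pow, FiniteField.coe_frobeniusAlgEquivOfAlgebraic, ZMod.card,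
    pow_iterate]

theorem map_aeval_of_intertwines {F k M V : Type*} [Field F] [Field k] [Algebra F k]
    [AddCommGroup M] [Module k M] [Module F M] [IsScalarTower F k M]
    [AddCommGroup V] [Module k V] [Module F V] [IsScalarTower F k V]
    {T : Module.End k M} {S : Module.End k V} (Φ : M →ₗ[F] V) (hΦ : ∀ x, Φ (T x) = S (Φ x))
    (Q : F[X]) (x : M) :
    Φ (aeval T (Q.map (algebraMap F k)) x) = aeval S (Q.map (algebraMap F k)) (Φ x) := by
  induction Q using Polynomial.induction_on' with
  | add P Q hP hQ => simp only [Polynomial.map_add, map_add, LinearMap.add_apply, hP, hQ]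
  | monomial n a =>
    have h (n : ℕ) : Φ ((T ^ n) x) = (S ^ n) (Φ x) := by
      induction n with
      | zero => rfl
      | succ n ih => rw [pow_succ', pow_succ', Module.End.mul_apply, hΦ, ih, Module.End.mul_apply]
    simp only [map_monomial, aeval_monomial, Module.End.mul_apply, Module.algebraMap_end_apply,
      algebraMap_smul, map_smul, h]

theorem isCoprime_X_sub_C_of_eval_ne_zero {K : Type*} [Field K] {Q : K[X]} {x : K}
    (h : Q.eval x ≠ 0) : IsCoprime (X - C x) Q :=
  ((irreducible_X_sub_C x).isCoprime_or_dvd Q).resolve_right fun h1 ↦ h (dvd_iff_isRoot.1 h1)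

/-- If `g` has determinant `1` and trace `τ`, conjugation by `g` has the eigenvalue `1` and those of
`g ^ 2`, whose trace is `τ ^ 2 - 2`; this is the corresponding polynomial identity. -/
theorem aeval_conj_eq_zero {k E : Type*} [Field k] [Ring E] [Algebra k E] {g g' : E} {τ σ : k}
    (hgg' : g * g' = 1) (hg : g * g = τ • g - 1) (hg' : g' = τ • 1 - g) (hσ : σ = τ ^ 2 - 2) :
    aeval (LinearMap.mulLeft k g * LinearMap.mulRight k g')
      ((X - 1) * (X ^ 2 - C σ * X + 1) : k[X]) = 0 := by
  have hg'2 : g' * g' = τ • g' - 1 := by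
    nth_rw 1 [hg']
    rw [sub_mul, smul_mul_assoc, one_mul, hgg']
  let L := LinearMap.mulLeft k g
  let R := LinearMap.mulRight k g'
  have hLR : L * R = R * L := LinearMap.ext fun x ↦ (mul_assoc _ _ _).symm
  have hL : L * L = τ • L - 1 := LinearMap.ext fun x ↦ by
    change g * (g * x) = τ • (g * x) - x
    rw [← mul_assoc, hg, sub_mul, smul_mul_assoc, one_mul]
  have hR : R * R = τ • R - 1 := LinearMap.ext fun x ↦ by
    change (x * g') * g' = τ • (x * g') - x
    rw [mul_assoc, hg'2, mul_sub, mul_smul_comm, mul_one]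
  change aeval (L * R) _ = 0
  have h2 : (L * R) * (L * R) = τ ^ 2 • (L * R) - τ • L - τ • R + 1 := by
    rw [mul_assoc, ← mul_assoc R, ← hLR, ← mul_assoc, ← mul_assoc, hL, mul_assoc, hR]
    simp only [mul_sub, sub_mul, smul_mul_smul_comm, mul_one, one_mul]
    rw [sq]; abel
  have h3 : L * R * L = τ • (L * R) - R := by
    rw [mul_assoc, ← hLR, ← mul_assoc, hL, sub_mul, smul_mul_assoc, one_mul]
  have h4 : L * R * R = τ • (L * R) - L := by
    rw [mul_assoc, hR, mul_sub, mul_smul_comm, mul_one]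
  simp only [map_mul, map_sub, map_add, map_pow, aeval_X, map_one, aeval_C, sq (L * R), h2,
    Algebra.algebraMap_eq_smul_one, smul_mul_assoc, one_mul]
  simp only [sub_mul, mul_sub, mul_add, one_mul, mul_smul_comm, mul_one, h2, h3, h4, hσ]
  module

/-- Let `ζ`, `ζ⁻¹` be the eigenvalues of `g`. Conjugation by `g` is killed by the product `Q` of
`X - 1` and the minimal polynomials of `ζ ^ 2` and `ζ⁻¹ ^ 2` over the prime field. An `𝔽_p`-linear
map intertwining conjugation by `g` with `g` also intertwines the values of `Q`, which has
coefficients in `𝔽_p`. If it is nonzero, `Q` and the characteristic polynomial of `g` have a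
common root, so that `ζ` or `ζ⁻¹` is conjugate to `ζ ^ 2` or `ζ⁻¹ ^ 2` over `𝔽_p`. -/
theorem exists_eq_pow_of_intertwines {p : ℕ} [Fact p.Prime] {k V K : Type*} [Field k]
    [Algebra (ZMod p) k] [AddCommGroup V] [Module k V] [Module (ZMod p) V]
    [IsScalarTower (ZMod p) k V] [Field K] [Finite K] [Algebra k K] [Algebra (ZMod p) K]
    [IsScalarTower (ZMod p) k K] {g g' : Module.End k V} {τ : k} (hgg' : g * g' = 1)
    (hg : g * g = τ • g - 1) (hg' : g' = τ • 1 - g) {ζ : Kˣ} (hζ : ζ ≠ 1)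
    (hτ : algebraMap k K τ = ζ + (ζ⁻¹ : Kˣ)) (Φ : Module.End k V →ₗ[ZMod p] V)
    (hΦ : ∀ x, Φ (g * x * g') = g (Φ x)) (hΦ0 : Φ ≠ 0) :
    ∃ (i : ℕ) (ε δ : ℤˣ), ζ ^ (2 * (δ : ℤ)) = (ζ ^ (ε : ℤ)) ^ p ^ i := by
  have : Module.Finite (ZMod p) K := Module.Finite.of_finite
  set z : K := ζ.val
  set z' : K := ζ⁻¹.val
  have hzz' : z * z' = 1 := by simp [z, z']
  let m₁ := minpoly (ZMod p) (z ^ 2)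
  let m₂ := minpoly (ZMod p) (z' ^ 2)
  let Q : (ZMod p)[X] := (X - 1) * (m₁ * m₂)
  have hm₁ : aeval (z ^ 2) m₁ = 0 := minpoly.aeval _ _
  have hm₂ : aeval (z' ^ 2) m₂ = 0 := minpoly.aeval _ _
  have hdvd : (X - 1) * (X ^ 2 - C (τ ^ 2 - 2) * X + 1) ∣ Q.map (algebraMap (ZMod p) k) := by
    simp only [Q, Polynomial.map_mul]
    refine mul_dvd_mul (by simp) ?_
    rw [← map_dvd_map' (algebraMap k K)]
    have h1 : (X ^ 2 - C (τ ^ 2 - 2) * X + 1 : k[X]).map (algebraMap k K) =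
        (X - C (z ^ 2)) * (X - C (z' ^ 2)) := by
      have h2 : algebraMap k K (τ ^ 2 - 2) = z ^ 2 + z' ^ 2 := by
        rw [map_sub, map_pow, hτ, map_ofNat]
        linear_combination 2 * hzz'
      have h3 : (C (z ^ 2) * C (z' ^ 2) : K[X]) = 1 := by
        rw [← C_mul, ← mul_pow, hzz', one_pow, C_1]
      simp only [Polynomial.map_add, Polynomial.map_sub, Polynomial.map_pow, Polynomial.map_mul,
        map_X, map_C, h2, Polynomial.map_one, C_add]
      linear_combination -h3
    rw [h1, Polynomial.map_mul, map_map, map_map, ← IsScalarTower.algebraMap_eq]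
    refine mul_dvd_mul ?_ ?_
    · rwa [dvd_iff_isRoot, IsRoot, eval_map_algebraMap]
    · rwa [dvd_iff_isRoot, IsRoot, eval_map_algebraMap]
  obtain ⟨x, hx⟩ : ∃ x, Φ x ≠ 0 := by
    by_contra! h
    exact hΦ0 (LinearMap.ext h)
  have hker : aeval g (Q.map (algebraMap (ZMod p) k)) (Φ x) = 0 := by
    rw [← map_aeval_of_intertwines (T := LinearMap.mulLeft k g * LinearMap.mulRight k g') Φ
      (fun x ↦ by rw [← hΦ, mul_assoc]; rfl)]
    obtain ⟨P, hP⟩ := hdvd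
    rw [hP, map_mul, aeval_conj_eq_zero hgg' hg hg' rfl, zero_mul, LinearMap.zero_apply, map_zero]
  have hroot : ∃ ε : ℤˣ, aeval ((ζ ^ (ε : ℤ) : Kˣ) : K) Q = 0 := by
    by_contra! h
    have hz := h 1
    have hz' := h (-1)
    simp only [Units.val_one, zpow_one, Units.val_neg, zpow_neg] at hz hz'
    rw [← eval_map_algebraMap] at hz hz'
    have hcop : IsCoprime (X ^ 2 - C τ * X + 1) (Q.map (algebraMap (ZMod p) k)) := by
      rw [← isCoprime_map (algebraMap k K), map_map, ← IsScalarTower.algebraMap_eq]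
      have h1 : (X ^ 2 - C τ * X + 1 : k[X]).map (algebraMap k K) = (X - C z) * (X - C z') := by
        have h3 : (C z * C z' : K[X]) = 1 := by rw [← C_mul, hzz', C_1]
        simp only [Polynomial.map_add, Polynomial.map_sub, Polynomial.map_pow, Polynomial.map_mul,
          map_X, map_C, hτ, Polynomial.map_one, C_add]
        linear_combination -h3
      rw [h1]
      exact (isCoprime_X_sub_C_of_eval_ne_zero hz).mul_left (isCoprime_X_sub_C_of_eval_ne_zero hz')
    obtain ⟨a, b, hab⟩ := hcop
    have h1 := congrArg (aeval g) hab
    simp only [map_add, map_mul, map_sub, map_pow, aeval_X, aeval_C, map_one] at h1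
    rw [sq, hg, Algebra.algebraMap_eq_smul_one, smul_mul_assoc, one_mul, sub_sub_cancel_left,
      neg_add_cancel, mul_zero, zero_add] at h1
    have h3 := congr($h1 (Φ x))
    rw [Module.End.mul_apply, hker, map_zero] at h3
    exact hx h3.symm
  obtain ⟨ε, hε⟩ := hroot
  have hne : ((ζ ^ (ε : ℤ) : Kˣ) : K) - 1 ≠ 0 := by
    rw [sub_ne_zero, ne_eq, Units.val_eq_one]
    rcases Int.units_eq_one_or ε with rfl | rfl <;> simpa using hζ
  simp only [Q, map_mul, map_sub, aeval_X, map_one, mul_eq_zero, hne, false_or] at hε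
  have key (δ : ℤˣ) (h : aeval ((ζ ^ (ε : ℤ) : Kˣ) : K)
      (minpoly (ZMod p) ((ζ ^ (2 * (δ : ℤ)) : Kˣ) : K)) = 0) :
      ∃ (i : ℕ) (ε δ : ℤˣ), ζ ^ (2 * (δ : ℤ)) = (ζ ^ (ε : ℤ)) ^ p ^ i := by
    have hint : IsIntegral (ZMod p) ((ζ ^ (2 * (δ : ℤ)) : Kˣ) : K) :=
      Algebra.IsIntegral.isIntegral _
    have h1 := minpoly.eq_of_irreducible_of_monic (minpoly.irreducible hint) h (minpoly.monic hint)
    have h3 : aeval ((ζ ^ (2 * (δ : ℤ)) : Kˣ) : K)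
        (minpoly (ZMod p) ((ζ ^ (ε : ℤ) : Kˣ) : K)) = 0 := by
      rw [← h1]; exact minpoly.aeval _ _
    obtain ⟨i, hi⟩ := exists_eq_pow_of_aeval_minpoly h3
    exact ⟨i, ε, δ, Units.ext (by rw [hi]; simp)⟩
  rcases hε with h | h
  · refine key 1 ?_
    simpa [m₁, z] using h
  · refine key (-1) ?_
    have : ((ζ ^ (2 * ((-1 : ℤˣ) : ℤ)) : Kˣ) : K) = z' ^ 2 := by
      simp only [Units.val_neg, Units.val_one, mul_neg, mul_one, zpow_neg, z',
        ← Units.val_pow_eq_pow_val,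
        inv_pow]
      rfl
    rwa [this]

theorem exists_pow_modEq_of_zpow_eq {p n i : ℕ} {G : Type*} [Group G] {ζ : G} (hn : orderOf ζ = n)
    {ε δ : ℤˣ} (h : ζ ^ (2 * (δ : ℤ)) = (ζ ^ (ε : ℤ)) ^ p ^ i) :
    ∃ ε' : ℤˣ, (p : ℤ) ^ i ≡ 2 * (ε' : ℤ) [ZMOD n] := by
  rw [← zpow_natCast, ← zpow_mul, zpow_eq_zpow_iff_modEq, hn] at h
  have h1 := (h.mul_left (ε : ℤ)).symm
  rw [← mul_assoc, ← Units.val_mul, Int.units_mul_self, Units.val_one, one_mul] at h1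
  exact ⟨ε * δ, by push_cast at h1 ⊢; convert h1 using 1; ring⟩

/-- In the case `n ∣ q + 1` the sign `ε` may be absorbed in the exponent, as `q = p ^ f ≡ -1` modulo
`n`. -/
theorem isExceptional_of_modEq {p : ℕ} [Fact p.Prime] {k : Type*} [Field k] [Finite k]
    [Algebra (ZMod p) k] {n i : ℕ} (hodd : Odd n) (h1 : 1 < n) {ε : ℤˣ}
    (h : (p : ℤ) ^ i ≡ 2 * (ε : ℤ) [ZMOD n])
    (hn : n ∣ Nat.card k - 1 ∨ n ∣ Nat.card k + 1) : IsExceptional p k n := by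
  have : Module.Finite (ZMod p) k := Module.Finite.of_finite
  have hcard : Nat.card k = p ^ Module.finrank (ZMod p) k := by
    rw [Module.natCard_eq_pow_finrank (K := ZMod p) (V := k), Nat.card_zmod]
  have hf : 0 < Module.finrank (ZMod p) k := Module.finrank_pos
  rw [hcard] at hn
  set f := Module.finrank (ZMod p) k
  have red (m : ℕ) (hm : (p : ℤ) ^ m ≡ 1 [ZMOD n]) (i : ℕ) :
      (p : ℤ) ^ (i % m) ≡ (p : ℤ) ^ i [ZMOD n] := by
    conv_rhs => rw [← Nat.mod_add_div i m, pow_add, pow_mul]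
    simpa using ((hm.pow (i / m)).mul_left ((p : ℤ) ^ (i % m))).symm
  refine ⟨hodd, h1, hn.imp (fun hn ↦ ⟨hn, ε, i % f, Nat.mod_lt _ hf, ?_⟩) fun hn ↦ ⟨hn, ?_⟩⟩
  · refine (red f ?_ i).trans h
    refine (Int.modEq_iff_dvd.2 ?_).symm
    have : 1 ≤ p ^ f := Nat.one_le_pow _ _ (Fact.out : p.Prime).pos
    have hn' : (n : ℤ) ∣ ((p ^ f - 1 : ℕ) : ℤ) := Int.natCast_dvd_natCast.2 hn
    rwa [Nat.cast_sub this, Nat.cast_pow, Nat.cast_one] at hn'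
  · have hf1 : (p : ℤ) ^ f ≡ -1 [ZMOD n] := by
      refine (Int.modEq_iff_dvd.2 ?_).symm
      zify at hn
      simpa using hn
    have hf2 : (p : ℤ) ^ (2 * f) ≡ 1 [ZMOD n] := by
      rw [mul_comm, pow_mul]
      simpa using hf1.pow 2
    rcases Int.units_eq_one_or ε with rfl | rfl
    · exact ⟨i % (2 * f), Nat.mod_lt _ (by omega), (red _ hf2 i).trans (by simpa using h)⟩
    · refine ⟨(i + f) % (2 * f), Nat.mod_lt _ (by omega), (red _ hf2 _).trans ?_⟩
      rw [pow_add]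
      simpa using h.mul hf1

end Arithmetic

/-! ### Equivariant additive maps from endomorphisms to the plane -/

section Homs

variable {k V : Type*} [Field k] [AddCommGroup V] [Module k V]

theorem mem_homInvariants_iff {F G V W : Type*} [CommRing F] [Group G]
    [AddCommGroup V] [Module F V] [AddCommGroup W] [Module F W]
    {ρ : Representation F G V} {σ : Representation F G W} {f : V →ₗ[F] W} :
    f ∈ homInvariants ρ σ ↔ ∀ g x, f (ρ g x) = σ g (f x) := by
  rw [Representation.mem_invariants]
  refine forall_congr' fun g ↦ ⟨fun h x ↦ ?_, fun h ↦ LinearMap.ext fun x ↦ ?_⟩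
  · rw [← h]
    change σ g (f (ρ g⁻¹ (ρ g x))) = σ g ((ρ.linHom σ g f) x)
    rw [h, ← Module.End.mul_apply, ← map_mul, inv_mul_cancel, map_one, Module.End.one_apply]
  · change σ g (f (ρ g⁻¹ x)) = f x
    rw [← h, ← Module.End.mul_apply, ← map_mul, mul_inv_cancel, map_one, Module.End.one_apply]

variable {F : Type*} [Field F] [Algebra F k] [Module F V] [IsScalarTower F k V]
  {H : Subgroup (GeneralLinearGroup k V)}

theorem adRep_apply (h : H) (X : Module.End k V) :
    adRep F H h X = h.1.val * X * h.1⁻¹.val := rfl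

/-- A scalar `c ≠ 1` in `H` acts trivially on endomorphisms, but not on any nonzero vector. -/
theorem homInvariants_eq_bot_of_smul_one_mem {h : GeneralLinearGroup k V} (hh : h ∈ H) {c : k}
    (hc : h.val = c • 1)
    (h1 : h ≠ 1) (W : Subrepresentation (adRep F H)) :
    homInvariants W.toRepresentation (restrictCoeff F (tautRep H)) = ⊥ := by
  rw [Submodule.eq_bot_iff]
  intro f hf
  rw [mem_homInvariants_iff] at hf
  ext w
  have h3 : W.toRepresentation ⟨h, hh⟩ w = w := by
    refine Subtype.ext ?_
    change h.val * w.1 * h⁻¹.val = w.1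
    have : h.val * w.1 = w.1 * h.val := by rw [hc]; simp
    rw [this, mul_assoc, Units.mul_inv, mul_one]
  have h4 := hf ⟨h, hh⟩ w
  rw [h3] at h4
  change f w = h.val (f w) at h4
  rw [hc, LinearMap.smul_apply, Module.End.one_apply] at h4
  have h5 : (1 - c) • f w = 0 := by rw [sub_smul, one_smul, ← h4, sub_self]
  rw [smul_eq_zero] at h5
  refine h5.resolve_left fun h6 ↦ h1 (Units.ext ?_)
  rw [hc, ← sub_eq_zero.1 h6, one_smul, Units.val_one]

theorem eq_zero_of_fixed (hV : Module.finrank k V = 2) (hH : (tautRep H).IsIrreducible) {v : V}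
    (hv : ∀ h ∈ H, h.val v = v) : v = 0 := by
  by_contra h0
  rcases eq_bot_or_eq_top_of_isIrreducible hH (k ∙ v) (fun h hh w hw ↦ by
    obtain ⟨c, rfl⟩ := Submodule.mem_span_singleton.1 hw
    rw [map_smul, hv h hh]
    exact Submodule.smul_mem _ _ (Submodule.mem_span_singleton_self v)) with h | h
  · exact h0 (Submodule.span_singleton_eq_bot.1 h)
  · have := finrank_span_singleton (K := k) h0
    rw [h, finrank_top, hV] at this
    omega

/-- By averaging, an equivariant map on `W` extends to an equivariant map on `End_k(V)`, which is
the sum of the scalars and `End_k^∘(V)`; scalars are fixed by `H`, whereas no nonzero vector is.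
-/
theorem homInvariants_eq_bot_of_adZero (hV : Module.finrank k V = 2) (h2 : (2 : k) ≠ 0)
    (hH : (tautRep H).IsIrreducible) [Finite H] (hcard : (Nat.card H : k) ≠ 0)
    (h0 : homInvariants (adZero F H).toRepresentation (restrictCoeff F (tautRep H)) = ⊥)
    (W : Subrepresentation (adRep F H)) :
    homInvariants W.toRepresentation (restrictCoeff F (tautRep H)) = ⊥ := by
  have : Fintype H := Fintype.ofFinite H
  rw [Submodule.eq_bot_iff]
  intro f hf
  rw [mem_homInvariants_iff] at hf
  obtain ⟨f₀, hf₀⟩ := f.exists_extend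
  -- the average of an arbitrary linear extension, up to the factor `#H`
  let f₁ : Module.End k V →ₗ[F] V :=
    ∑ g, (adRep F H).linHom (restrictCoeff F (tautRep H)) g f₀
  have hf₁ : f₁ ∈ homInvariants (adRep F H) (restrictCoeff F (tautRep H)) := by
    rw [Representation.mem_invariants]
    intro h
    rw [map_sum]
    refine Eq.trans ?_ ((Group.mulLeft_bijective h).sum_comp (fun g ↦
      (adRep F H).linHom (restrictCoeff F (tautRep H)) g f₀))
    exact Finset.sum_congr rfl fun g _ ↦ by rw [map_mul]; rfl
  rw [mem_homInvariants_iff] at hf₁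
  have hf₁0 (X : Module.End k V) : f₁ X = 0 := by
    have h1 : f₁.comp (adZero F H).toSubmodule.subtype ∈
        homInvariants (adZero F H).toRepresentation (restrictCoeff F (tautRep H)) :=
      mem_homInvariants_iff.2 fun g x ↦ hf₁ g x.1
    rw [h0, Submodule.mem_bot] at h1
    have h3 (c : k) : f₁ (c • 1) = 0 := by
      refine eq_zero_of_fixed hV hH fun h hh ↦ ?_
      refine (hf₁ ⟨h, hh⟩ (c • 1)).symm.trans ?_
      rw [adRep_apply, mul_smul_comm, mul_one, smul_mul_assoc, Units.mul_inv]
    have h4 : X - (LinearMap.trace k V X / 2) • 1 ∈ (adZero F H).toSubmodule := by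
      change LinearMap.trace k V _ = 0
      rw [map_sub, map_smul, trace_one_of_finrank_eq_two hV, smul_eq_mul, div_mul_cancel₀ _ h2,
        sub_self]
    have h5 : f₁ (X - (LinearMap.trace k V X / 2) • 1) = 0 := congr($h1 ⟨_, h4⟩)
    rwa [map_sub, h3, sub_zero] at h5
  ext w
  have h6 : f₁ w.1 = Nat.card H • f w := by
    rw [LinearMap.sum_apply, Finset.sum_congr rfl (g := fun _ ↦ f w), Finset.sum_const,
      Finset.card_univ, Nat.card_eq_fintype_card]
    intro g _
    change restrictCoeff F (tautRep H) g (f₀ (adRep F H g⁻¹ w.1)) = f w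
    have h7 : f₀ (adRep F H g⁻¹ w.1) = f (W.toRepresentation g⁻¹ w) :=
      congr($hf₀ (W.toRepresentation g⁻¹ w))
    rw [h7, hf, ← Module.End.mul_apply, ← map_mul, mul_inv_cancel, map_one, Module.End.one_apply]
  rw [hf₁0, eq_comm, ← Nat.cast_smul_eq_nsmul k, smul_eq_zero] at h6
  exact h6.resolve_left hcard

/-- Extend an equivariant map by zero on the scalars. -/
theorem exists_intertwining_of_homInvariants_ne_bot (hV : Module.finrank k V = 2)
    (h2 : (2 : k) ≠ 0)
    (h0 : homInvariants (adZero F H).toRepresentation (restrictCoeff F (tautRep H)) ≠ ⊥) :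
    ∃ Φ : Module.End k V →ₗ[F] V, Φ ≠ 0 ∧ ∀ h ∈ H, ∀ X, Φ (h.val * X * h⁻¹.val) = h.val (Φ X) := by
  obtain ⟨f, hf, hf0⟩ := Submodule.exists_mem_ne_zero_of_ne_bot h0
  rw [mem_homInvariants_iff] at hf
  let P : Module.End k V →ₗ[k] Module.End k V :=
    LinearMap.id - (2⁻¹ : k) • (LinearMap.trace k V).smulRight 1
  have hPapp (X) : P X = X - (2⁻¹ * LinearMap.trace k V X) • 1 := by simp [P, smul_smul]
  have hP (X) : P X ∈ (adZero F H).toSubmodule := by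
    change LinearMap.trace k V _ = 0
    rw [hPapp, map_sub, map_smul, trace_one_of_finrank_eq_two hV, smul_eq_mul]
    field_simp
    ring
  refine ⟨f.comp ((P.restrictScalars F).codRestrict _ hP), ?_, fun h hh X ↦ ?_⟩
  · contrapose! hf0
    ext w
    have h3 : P w.1 = w.1 := by
      rw [hPapp, show LinearMap.trace k V w.1 = 0 from w.2, mul_zero, zero_smul, sub_zero]
    have h4 : f ⟨P w.1, hP w.1⟩ = 0 := congr($hf0 w.1)
    have h5 : (⟨P w.1, hP w.1⟩ : (adZero F H).toSubmodule) = w := Subtype.ext h3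
    rwa [h5] at h4
  · have h3 : P (h.val * X * h⁻¹.val) = h.val * P X * h⁻¹.val := by
      rw [hPapp, hPapp, LinearMap.trace_mul_comm, ← mul_assoc, Units.inv_mul, one_mul, mul_sub,
        sub_mul, mul_smul_comm, mul_one, smul_mul_assoc, Units.mul_inv]
    have h4 := hf ⟨h, hh⟩ ⟨P X, hP X⟩
    have h5 : (adZero F H).toRepresentation ⟨h, hh⟩ ⟨P X, hP X⟩ = ⟨_, hP (h.val * X * h⁻¹.val)⟩ :=
      Subtype.ext h3.symm
    rw [h5] at h4
    exact h4

/-- Transport of an additive, equivariant map along an isomorphism of pairs. Additivity suffices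
over the prime field. -/
theorem homInvariants_adZero_ne_bot_of_isOfForm {p : ℕ} [Fact p.Prime] [Algebra (ZMod p) k]
    [Module (ZMod p) V] [IsScalarTower (ZMod p) k V]
    {G U : Type*} [Group G] [AddCommGroup U] [Module k U] {σ : Representation k G U}
    (hf : IsOfForm H σ) (φ : Module.End k U →+ U) (hφ : ∀ g X, φ (σ g * X * σ g⁻¹) = σ g (φ X))
    {X₀ : Module.End k U} (htr : LinearMap.trace k U X₀ = 0) (h0 : φ X₀ ≠ 0) :
    homInvariants (adZero (ZMod p) H).toRepresentation
      (restrictCoeff (ZMod p) (tautRep H)) ≠ ⊥ := by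
  obtain ⟨e, ⟨E⟩⟩ := hf
  let E' : U ≃ₗ[k] V := E.toLinearEquiv
  have hE (g x) : E' (σ g x) = (e g).1.val (E' x) :=
    congr($(E.toIntertwiningMap.isIntertwining' g) x)
  have hE' (g y) : E'.symm ((e g).1.val y) = σ g (E'.symm y) := by
    rw [LinearEquiv.symm_apply_eq, hE, LinearEquiv.apply_symm_apply]
  let ψ : Module.End k V →+ V := E'.toAddMonoidHom.comp (φ.comp E'.symm.conj.toAddMonoidHom)
  have hψ (X) : ψ X = E' (φ (E'.symm.conj X)) := rfl
  let f : (adZero (ZMod p) H).toSubmodule →ₗ[ZMod p] V :=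
    AddMonoidHom.toZModLinearMap p (ψ.comp (adZero (ZMod p) H).toSubmodule.subtype.toAddMonoidHom)
  have hf (w) : f w = E' (φ (E'.symm.conj w.1)) := rfl
  have hmem : f ∈ homInvariants (adZero (ZMod p) H).toRepresentation
      (restrictCoeff (ZMod p) (tautRep H)) := by
    rw [mem_homInvariants_iff]
    intro h x
    obtain ⟨g, rfl⟩ := e.surjective h
    rw [hf, hf]
    change E' (φ (E'.symm.conj ((e g).1.val * x.1 * (e g).1⁻¹.val))) = (e g).1.val (E' (φ _))
    rw [← hE, ← hφ]
    congr 2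
    ext y
    have h3 : (e g).1⁻¹.val = (e g⁻¹).1.val := by rw [map_inv]; rfl
    rw [h3]
    simp only [LinearEquiv.conj_apply, LinearMap.comp_apply, Module.End.mul_apply,
      LinearEquiv.coe_coe, LinearEquiv.symm_symm, hE, hE']
  intro hbot
  rw [hbot, Submodule.mem_bot] at hmem
  have htr' : E'.conj X₀ ∈ (adZero (ZMod p) H).toSubmodule := by
    change LinearMap.trace k V _ = 0
    rw [LinearMap.trace_conj', htr]
  have h3 := hf ⟨E'.conj X₀, htr'⟩
  rw [hmem, LinearMap.zero_apply, eq_comm, LinearEquiv.map_eq_zero_iff] at h3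
  refine h0 ?_
  convert h3
  ext y
  simp [LinearEquiv.conj_apply]

end Homs

/-! ### Nonzero equivariant maps in the exceptional cases -/

section Converse

variable {k V : Type*} [Field k] [AddCommGroup V] [Module k V]

theorem isOfForm_injective {H : Subgroup (GeneralLinearGroup k V)} {G U : Type*} [Group G]
    [AddCommGroup U]
    [Module k U] {σ : Representation k G U} (hf : IsOfForm H σ) {g : G} (hg : σ g = 1) : g = 1 := by
  obtain ⟨e, ⟨E⟩⟩ := hf
  rw [← map_eq_one_iff e e.injective]
  refine Subtype.ext (Units.ext (LinearMap.ext fun y ↦ ?_))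
  obtain ⟨x, rfl⟩ := E.toLinearEquiv.surjective y
  have h : E.toLinearEquiv (σ g x) = (e g).1.val (E.toLinearEquiv x) :=
    congr($(E.toIntertwiningMap.isIntertwining' g) x)
  rw [← h, hg]
  rfl

/-- The equivariance condition on a map holds for a product if it holds for both factors. -/
theorem map_conj_mul {G U : Type*} [Group G] [AddCommGroup U] [Module k U]
    {σ : Representation k G U} {φ : Module.End k U → U} {g h : G}
    (hg : ∀ X, φ (σ g * X * σ g⁻¹) = σ g (φ X)) (hh : ∀ X, φ (σ h * X * σ h⁻¹) = σ h (φ X))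
    (X : Module.End k U) : φ (σ (g * h) * X * σ (g * h)⁻¹) = σ (g * h) (φ X) := by
  rw [mul_inv_rev, map_mul, map_mul, Module.End.mul_apply, ← hh, ← hg]
  simp only [mul_assoc]

/-- If `p ^ i ≡ 2 ε` modulo the order of `ζ`, and `ζ ^ p ^ (i + j) = ζ`, the `p ^ j`-th power map
takes `ζ ^ 2` to `ζ ^ ε`. -/
theorem pow_two_mul_eq_zpow {G : Type*} [Group G] {n p i j : ℕ} {ζ : G} (hζ : ζ ^ n = 1) {ε : ℤˣ}
    (h : (p : ℤ) ^ i ≡ 2 * (ε : ℤ) [ZMOD n]) (hp : ζ ^ p ^ (i + j) = ζ) :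
    (ζ ^ 2) ^ p ^ j = ζ ^ (ε : ℤ) := by
  have h1 : ζ ^ (p ^ i) = ζ ^ (2 * (ε : ℤ)) := by
    rw [← zpow_natCast, zpow_eq_zpow_iff_modEq]
    push_cast
    exact h.of_dvd (Int.natCast_dvd_natCast.2 (orderOf_dvd_of_pow_eq_one hζ))
  rw [pow_add, pow_mul, h1] at hp
  conv_rhs => rw [← hp]
  rw [← zpow_natCast, ← zpow_natCast, ← zpow_natCast, ← zpow_mul, ← zpow_mul, ← zpow_mul]
  congr 1
  have := Int.units_mul_self ε
  have h3 : (ε : ℤ) * ε = 1 := by rw [← Units.val_mul, this, Units.val_one]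
  push_cast
  linear_combination (-2 * (p : ℤ) ^ j) * h3

theorem not_dvd_add_one {n q : ℕ} (hodd : Odd n) (h1 : 1 < n) (hq : 1 ≤ q) (h : n ∣ q - 1) :
    ¬ n ∣ q + 1 := by
  intro h'
  have h3 : n ∣ 2 := by
    have := Nat.dvd_sub h' h
    rwa [show q + 1 - (q - 1) = 2 by omega] at this
  have := Nat.le_of_dvd (by norm_num) h3
  obtain ⟨m, rfl⟩ := hodd
  omega

section NonSplit

variable {k₂ : Type*} [Field k₂] [Algebra k k₂] [Finite k]

/-- Up to the factor `2`, the conjugation-semilinear part of a `k`-linear endomorphism of the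
quadratic extension `k₂ = k(α)`, where `α ^ 2 ∈ k`: every such endomorphism is
`x ↦ β x + γ conj(x)` for unique `β` and `γ`, and `semilinearPart α` takes it to `2 γ`. -/
def semilinearPart (α : k₂) : Module.End k k₂ →+ k₂ where
  toFun X := X 1 - α⁻¹ * X α
  map_zero' := by simp
  map_add' X Y := by simp only [LinearMap.add_apply]; ring

/-- Multiplication by `z` of norm one conjugates `x ↦ γ conj(x)` to `x ↦ z ^ 2 γ conj(x)`. -/
theorem semilinearPart_mul (h₂ : Module.finrank k k₂ = 2) (h2 : (2 : k) ≠ 0)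
    {d : k} (hd : ∀ c, d ≠ c * c) {α : k₂} (hα : α * α = algebraMap k k₂ d) {n : ℕ}
    (ψ' : Cyc n →* normOne k k₂) (a : Cyc n) (X : Module.End k k₂) :
    semilinearPart α (mulChar ψ' a * X * mulChar ψ' a⁻¹) =
      ((ψ' a : k₂ˣ) : k₂) ^ 2 * semilinearPart α X := by
  have hα0 : α ≠ 0 := by
    rintro rfl
    rw [mul_zero, eq_comm, map_eq_zero] at hα
    exact hd 0 (by rw [hα, mul_zero])
  set z : k₂ := ((ψ' a : k₂ˣ) : k₂)
  set u : k₂ := ((ψ' a⁻¹ : k₂ˣ) : k₂) with hu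
  obtain ⟨x, y, hxy⟩ := exists_eq_smul_add_smul h₂ (linearIndependent_one_of_mul_self hd hα) u
  have hconj : algebraMap k k₂ x - algebraMap k k₂ y * α = z := by
    rw [← conj_algebraMap_add_mul h2 hd hα]
    rw [Algebra.smul_def, Algebra.smul_def, mul_one] at hxy
    rw [← hxy, hu, conj_normOne h₂, map_inv, inv_inv]
  have h1 : X u = algebraMap k k₂ x * X 1 + algebraMap k k₂ y * X α := by
    rw [hxy, map_add, map_smul, map_smul, Algebra.smul_def, Algebra.smul_def]
  have h3 : X (u * α) = algebraMap k k₂ x * X α + algebraMap k k₂ y * (α * α * X 1) := by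
    rw [hxy, add_mul, smul_mul_assoc, one_mul, smul_mul_assoc, hα, map_add, map_smul, map_smul,
      Algebra.algebraMap_eq_smul_one d, map_smul, Algebra.smul_def, Algebra.smul_def,
      smul_mul_assoc, one_mul]
  change z * X (u * 1) - α⁻¹ * (z * X (u * α)) = z ^ 2 * (X 1 - α⁻¹ * X α)
  rw [mul_one, h1, h3, ← hconj]
  field_simp
  ring

theorem semilinearPart_conj (h2 : (2 : k) ≠ 0)
    {d : k} (hd : ∀ c, d ≠ c * c) {α : k₂} (hα : α * α = algebraMap k k₂ d)
    (X : Module.End k k₂) :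
    semilinearPart α (conj k k₂ * X * conj k k₂) = conj k k₂ (semilinearPart α X) := by
  have hc := conj_eq_neg_of_mul_self h2 hd hα
  have hmul (x y : k₂) : conj k k₂ (x * y) = conj k k₂ x * conj k k₂ y := by
    simp only [conj_apply, mul_pow]
  have hinv : conj k k₂ α⁻¹ = -α⁻¹ := by
    rw [conj_apply, inv_pow, ← conj_apply, hc, inv_neg]
  have h1 : conj k k₂ 1 = 1 := by rw [conj_apply, one_pow]
  change conj k k₂ (X (conj k k₂ 1)) - α⁻¹ * conj k k₂ (X (conj k k₂ α)) =
    conj k k₂ (X 1 - α⁻¹ * X α)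
  rw [h1, hc, map_neg, map_neg, map_sub, hmul, hinv]
  ring

theorem dvd_natCard_add_one (h₂ : Module.finrank k k₂ = 2) {n : ℕ} {ψ' : Cyc n →* normOne k k₂}
    (hψ' : ∀ a, ψ' a = 1 → a = 1) : n ∣ Nat.card k + 1 := by
  have h : ψ' ((Multiplicative.ofAdd 1) ^ (Nat.card k + 1)) = 1 := by
    refine Subtype.ext (Units.ext ?_)
    rw [map_pow]
    have h1 : Algebra.norm k ((ψ' (.ofAdd 1) : k₂ˣ) : k₂) = 1 :=
      congrArg Units.val (ψ' (.ofAdd 1)).2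
    rw [norm_eq_one_iff h₂, conj_apply, ← pow_succ'] at h1
    exact h1
  have h1 := congrArg Multiplicative.toAdd (hψ' _ h)
  rw [toAdd_pow, toAdd_ofAdd, nsmul_eq_mul, mul_one, toAdd_one] at h1
  exact (ZMod.natCast_eq_zero_iff _ _).1 h1

/-- If `p ^ i ≡ 2` modulo `n` and `j = 2 f - i`, the map `X ↦ γ ^ p ^ j`, where `γ` is the
semilinear part of `X`, is equivariant. It does not vanish on the conjugation of `k₂`, which has
trace zero. -/
theorem homInvariants_ne_bot_of_nonsplit {p : ℕ} [Fact p.Prime] [Algebra (ZMod p) k]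
    [Module (ZMod p) V] [IsScalarTower (ZMod p) k V] (h2 : (2 : k) ≠ 0)
    (h₂ : Module.finrank k k₂ = 2) {H : Subgroup (GeneralLinearGroup k V)} {n : ℕ}
    (hn : IsExceptional p k n)
    (ψ' : Cyc n →* normOne k k₂) (hψ' : ∀ a, ψ' a = 1 → a = 1)
    (hf : IsOfForm H ((repJ h₂ ψ').comp (rot n)) ∨ IsOfForm H (repJ h₂ ψ')) :
    homInvariants (adZero (ZMod p) H).toRepresentation
      (restrictCoeff (ZMod p) (tautRep H)) ≠ ⊥ := by
  have : Module.Finite (ZMod p) k := Module.Finite.of_finite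
  have : Module.Finite k k₂ := Module.finite_of_finrank_eq_succ h₂
  have : Finite k₂ := Module.finite_of_finite k
  have hcard : Nat.card k = p ^ Module.finrank (ZMod p) k := by
    rw [Module.natCard_eq_pow_finrank (K := ZMod p) (V := k), Nat.card_zmod]
  obtain ⟨hodd, h1, hn⟩ := hn
  rw [← hcard] at hn
  obtain ⟨-, i, hi, hpi⟩ := hn.resolve_left fun h ↦
    not_dvd_add_one hodd h1 Nat.card_pos h.1 (dvd_natCard_add_one h₂ hψ')
  set f := Module.finrank (ZMod p) k
  -- by the choice of `j`, the `p ^ (i + j)`-th power map is the identity of `k₂`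
  let j := 2 * f - i
  have hpow (a : Cyc n) : (((ψ' a : k₂ˣ) : k₂) ^ 2) ^ p ^ j = ((ψ' a : k₂ˣ) : k₂) := by
    have h3 : (ψ' a : k₂ˣ) ^ n = 1 := by
      have : a ^ n = 1 := by
        rw [← toAdd_eq_zero, toAdd_pow, nsmul_eq_mul, ZMod.natCast_self, zero_mul]
      rw [← Subgroup.coe_pow, ← map_pow, this, map_one, Subgroup.coe_one]
    have h4 := pow_two_mul_eq_zpow (i := i) (j := j) (p := p) (ε := 1) h3 (by simpa using hpi) (by
      let _ := Fintype.ofFinite k₂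
      have h5 : p ^ (i + j) = Fintype.card k₂ := by
        rw [← Nat.card_eq_fintype_card, natCard_eq_mul_self h₂, hcard, ← pow_add]
        congr 1
        omega
      refine Units.ext ?_
      rw [h5, Units.val_pow_eq_pow_val, FiniteField.pow_card])
    simpa using congrArg Units.val h4
  obtain ⟨d, hd⟩ := FiniteField.exists_nonsquare (F := k) (ringChar_ne_two h2)
  replace hd (c : k) : d ≠ c * c := fun h ↦ hd ⟨c, h⟩
  have hd0 : d ≠ 0 := fun h ↦ hd 0 (by rw [h, mul_zero])
  obtain ⟨α, hα⟩ := exists_mul_self_eq_algebraMap h₂ h2 d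
  have hα0 : α ≠ 0 := by
    rintro rfl
    rw [mul_zero, eq_comm, map_eq_zero] at hα
    exact hd0 hα
  have : CharP k p := charP_of_injective_algebraMap' (ZMod p) p
  have : CharP k₂ p := charP_of_injective_algebraMap' k p
  have : ExpChar k₂ p := .prime Fact.out
  let φ : Module.End k k₂ →+ k₂ :=
    (iterateFrobenius k₂ p j).toAddMonoidHom.comp (semilinearPart α)
  have hφ (X) : φ X = semilinearPart α X ^ p ^ j := rfl
  have hrot (a : Cyc n) (X) : φ (repJ h₂ ψ' (rot n a) * X * repJ h₂ ψ' (rot n a)⁻¹) =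
      repJ h₂ ψ' (rot n a) (φ X) := by
    change φ (mulChar ψ' a * X * mulChar ψ' a⁻¹) = ((ψ' a : k₂ˣ) : k₂) * φ X
    rw [hφ, semilinearPart_mul h₂ h2 hd hα, mul_pow, hpow, hφ]
  have hs (X) : φ (repJ h₂ ψ' (.sr 0) * X * repJ h₂ ψ' (.sr 0)⁻¹) =
      repJ h₂ ψ' (.sr 0) (φ X) := by
    have hs0 : repJ h₂ ψ' (.sr 0) = conj k k₂ := by
      change conj k k₂ * mulChar ψ' 1 = _
      rw [mulChar_one, mul_one]
    have hs1 : (.sr 0 : DihedralGroup n)⁻¹ = .sr 0 := rfl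
    rw [hs1, hs0, hφ, semilinearPart_conj h2 hd hα, hφ]
    simp only [conj_apply, ← pow_mul, mul_comm]
  have htr : LinearMap.trace k k₂ (conj k k₂) = 0 := by
    refine trace_eq_zero_of_anticommute h2 (A := Algebra.lmul k k₂ α) hd0 ?_ ?_
    · rw [← map_mul, hα, AlgHom.commutes, Algebra.algebraMap_eq_smul_one]
    · ext x
      change conj k k₂ (α * x) = -(α * conj k k₂ x)
      rw [conj_apply, mul_pow, ← conj_apply, ← conj_apply, conj_eq_neg_of_mul_self h2 hd hα,
        neg_mul]
  have hne : φ (conj k k₂) ≠ 0 := by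
    have h3 : semilinearPart α (conj k k₂) = 2 := by
      change conj k k₂ 1 - α⁻¹ * conj k k₂ α = 2
      rw [conj_eq_neg_of_mul_self h2 hd hα, conj_apply, one_pow, mul_neg, inv_mul_cancel₀ hα0]
      norm_num
    rw [hφ, h3]
    exact pow_ne_zero _ (two_ne_zero_of_algebra k₂ h2)
  rcases hf with hf | hf
  · exact homInvariants_adZero_ne_bot_of_isOfForm hf φ (fun a X ↦ hrot a X) htr hne
  · refine homInvariants_adZero_ne_bot_of_isOfForm hf φ (fun g X ↦ ?_) htr hne
    rcases g with i | i
    · exact hrot (.ofAdd i) X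
    · have h3 : DihedralGroup.sr i = .sr 0 * rot n (.ofAdd i) := by
        change _ = DihedralGroup.sr (0 + i)
        rw [zero_add]
      rw [h3]
      exact map_conj_mul hs (hrot (.ofAdd i)) X

end NonSplit

section Split

/-- The model of `I(ψ)` on `k × k` in which the rotations act diagonally through `ψ` and `ψ⁻¹`, and
the reflection `sr 0` swaps the coordinates. -/
def splitRep {n : ℕ} (ψ : Cyc n →* kˣ) : Representation k (DihedralGroup n) (k × k) :=
  dihedralHom
    { toFun a := LinearMap.prodMap ((ψ a : k) • 1) (((ψ a)⁻¹ : kˣ).val • 1)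
      map_one' := by ext <;> simp
      map_mul' a b := by ext <;> simp [mul_comm] }
    (LinearEquiv.prodComm k k k).toLinearMap (by ext <;> simp) (fun a ↦ by ext <;> simp)

theorem splitRep_rot_apply {n : ℕ} (ψ : Cyc n →* kˣ) (a : Cyc n) (x : k × k) :
    splitRep ψ (rot n a) x = (ψ a * x.1, ((ψ a)⁻¹ : kˣ).val * x.2) := rfl

theorem splitRep_sr_zero_apply {n : ℕ} (ψ : Cyc n →* kˣ) (x : k × k) :
    splitRep ψ (.sr 0) x = (x.2, x.1) := by
  change Prod.swap (splitRep ψ (rot n 1) x) = _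
  rw [splitRep_rot_apply]
  simp
  rfl

theorem nonempty_repI_equiv_splitRep {n : ℕ} (ψ : Cyc n →* kˣ) :
    Nonempty ((repI ψ).Equiv (splitRep ψ)) := by
  refine nonempty_repI_equiv ψ _ (by simp) (v := (1, 0)) (fun a ↦ ?_) ?_
  · rw [splitRep_rot_apply]; simp
  · rw [splitRep_sr_zero_apply, LinearIndependent.pair_iff]
    intro x y h
    simpa using h

theorem isOfForm_splitRep {H : Subgroup (GeneralLinearGroup k V)} {n : ℕ} {ψ : Cyc n →* kˣ}
    (hf : IsOfForm H (repI ψ)) : IsOfForm H (splitRep ψ) := by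
  obtain ⟨e, ⟨E⟩⟩ := hf
  obtain ⟨E'⟩ := nonempty_repI_equiv_splitRep ψ
  exact ⟨e, ⟨E'.symm.trans E⟩⟩

/-- In the model `splitRep ψ`, an endomorphism has off-diagonal entries `b`, `c`, on which a
rotation acts through `ψ ^ 2` and `ψ⁻¹ ^ 2`. If `p ^ i ≡ 2 ε` modulo `n` and `j = f - i`, the map
to `(b ^ p ^ j, c ^ p ^ j)`, or to `(c ^ p ^ j, b ^ p ^ j)` if `ε = -1`, is equivariant. It does
not vanish on the swap of the coordinates, which has trace zero. -/
theorem homInvariants_ne_bot_of_split [Finite k] {p : ℕ} [Fact p.Prime] [Algebra (ZMod p) k]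
    [Module (ZMod p) V] [IsScalarTower (ZMod p) k V] (h2 : (2 : k) ≠ 0)
    {H : Subgroup (GeneralLinearGroup k V)} {n : ℕ} (hn : IsExceptional p k n)
    (ψ : Cyc n →* kˣ) (hf : IsOfForm H (repI ψ)) :
    homInvariants (adZero (ZMod p) H).toRepresentation
      (restrictCoeff (ZMod p) (tautRep H)) ≠ ⊥ := by
  replace hf := isOfForm_splitRep hf
  have : Module.Finite (ZMod p) k := Module.Finite.of_finite
  have hcard : Nat.card k = p ^ Module.finrank (ZMod p) k := by
    rw [Module.natCard_eq_pow_finrank (K := ZMod p) (V := k), Nat.card_zmod]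
  have hdvd : n ∣ Nat.card k - 1 := by
    have h : splitRep ψ (rot n ((Multiplicative.ofAdd 1) ^ (Nat.card k - 1))) = 1 := by
      have h1 : ψ ((Multiplicative.ofAdd 1) ^ (Nat.card k - 1)) = 1 := by
        rw [map_pow]
        refine Units.ext ?_
        rw [Units.val_pow_eq_pow_val, pow_natCard_sub_one (Units.ne_zero _), Units.val_one]
      refine LinearMap.ext fun x ↦ ?_
      rw [splitRep_rot_apply, h1]
      simp
    have h1 : DihedralGroup.r (((Multiplicative.ofAdd (1 : ZMod n)) ^ (Nat.card k - 1)).toAdd) =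
      DihedralGroup.r 0 := isOfForm_injective hf h
    rw [DihedralGroup.r.injEq, toAdd_pow, toAdd_ofAdd, nsmul_eq_mul, mul_one] at h1
    exact (ZMod.natCast_eq_zero_iff _ _).1 h1
  obtain ⟨hodd, h1, hn⟩ := hn
  rw [← hcard] at hn
  obtain ⟨-, ε, i, hi, hpi⟩ := hn.resolve_right fun h ↦
    not_dvd_add_one hodd h1 Nat.card_pos hdvd h.1
  set f := Module.finrank (ZMod p) k
  let j := f - i
  have hpow (a : Cyc n) : (ψ a ^ 2) ^ p ^ j = ψ a ^ (ε : ℤ) := by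
    have h3 : ψ a ^ n = 1 := by
      have : a ^ n = 1 := by
        rw [← toAdd_eq_zero, toAdd_pow, nsmul_eq_mul, ZMod.natCast_self, zero_mul]
      rw [← map_pow, this, map_one]
    refine pow_two_mul_eq_zpow (i := i) h3 hpi ?_
    let _ := Fintype.ofFinite k
    have h5 : p ^ (i + j) = Fintype.card k := by
      rw [← Nat.card_eq_fintype_card, hcard]
      congr 1
      omega
    refine Units.ext ?_
    rw [h5, Units.val_pow_eq_pow_val, FiniteField.pow_card]
  have : CharP k p := charP_of_injective_algebraMap' (ZMod p) p
  have : ExpChar k p := .prime Fact.out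
  let F := iterateFrobenius k p j
  have hF (x : k) : F x = x ^ p ^ j := rfl
  let s : Module.End k (k × k) := (LinearEquiv.prodComm k k k).toLinearMap
  have hs1 : (.sr 0 : DihedralGroup n)⁻¹ = .sr 0 := rfl
  have hs (x : k × k) : s x = (x.2, x.1) := rfl
  have hsr (x : k × k) : splitRep ψ (.sr 0) x = (x.2, x.1) := splitRep_sr_zero_apply ψ x
  have htr : LinearMap.trace k (k × k) s = 0 := by
    refine trace_eq_zero_of_anticommute h2 (A := LinearMap.prodMap 1 (-1)) one_ne_zero ?_ ?_
    · ext <;> simp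
    · ext <;> simp [hs]
  have hsri (i : ZMod n) : DihedralGroup.sr i = .sr 0 * rot n (.ofAdd i) := by
    change _ = DihedralGroup.sr (0 + i)
    rw [zero_add]
  -- the off-diagonal entries of a conjugate by a rotation
  have hb (a : Cyc n) (X : Module.End k (k × k)) :
      ((splitRep ψ (rot n a) * X * splitRep ψ (rot n a)⁻¹) (0, 1)).1 =
        ((ψ a ^ 2 : kˣ) : k) * (X (0, 1)).1 := by
    have h3 : splitRep ψ (rot n a)⁻¹ (0, 1) = (ψ a : k) • (0, 1) := by
      rw [← map_inv, splitRep_rot_apply]; simp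
    rw [Module.End.mul_apply, h3, map_smul, Module.End.mul_apply, splitRep_rot_apply]
    simp [sq, mul_assoc]
  have hc (a : Cyc n) (X : Module.End k (k × k)) :
      ((splitRep ψ (rot n a) * X * splitRep ψ (rot n a)⁻¹) (1, 0)).2 =
        (((ψ a ^ 2)⁻¹ : kˣ) : k) * (X (1, 0)).2 := by
    have h3 : splitRep ψ (rot n a)⁻¹ (1, 0) = ((ψ a)⁻¹ : kˣ).val • (1, 0) := by
      rw [← map_inv, splitRep_rot_apply]; simp
    rw [Module.End.mul_apply, h3, map_smul, Module.End.mul_apply, splitRep_rot_apply]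
    simp [sq, mul_assoc]
  have hpow' (u : kˣ) (x : k) : ((u : k) * x) ^ p ^ j = (u ^ p ^ j : kˣ) * x ^ p ^ j := by
    rw [mul_pow, Units.val_pow_eq_pow_val]
  rcases Int.units_eq_one_or ε with rfl | rfl
  · let φ : Module.End k (k × k) →+ k × k :=
      { toFun X := (F (X (0, 1)).1, F (X (1, 0)).2)
        map_zero' := by simp
        map_add' X Y := by simp }
    have hφ (X) : φ X = ((X (0, 1)).1 ^ p ^ j, (X (1, 0)).2 ^ p ^ j) := rfl
    have hrot (a : Cyc n) (X) : φ (splitRep ψ (rot n a) * X * splitRep ψ (rot n a)⁻¹) =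
        splitRep ψ (rot n a) (φ X) := by
      rw [hφ, hb, hc, hpow', hpow', inv_pow, hpow, splitRep_rot_apply, hφ]
      simp
    refine homInvariants_adZero_ne_bot_of_isOfForm hf φ (fun g X ↦ ?_) htr (by simp [hφ, hs])
    rcases g with i | i
    · exact hrot (.ofAdd i) X
    · rw [hsri]
      exact map_conj_mul (fun X ↦ by simp [hφ, hsr, hs1]) (hrot (.ofAdd i)) X
  · let φ : Module.End k (k × k) →+ k × k :=
      { toFun X := (F (X (1, 0)).2, F (X (0, 1)).1)
        map_zero' := by simp
        map_add' X Y := by simp }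
    have hφ (X) : φ X = ((X (1, 0)).2 ^ p ^ j, (X (0, 1)).1 ^ p ^ j) := rfl
    have hrot (a : Cyc n) (X) : φ (splitRep ψ (rot n a) * X * splitRep ψ (rot n a)⁻¹) =
        splitRep ψ (rot n a) (φ X) := by
      rw [hφ, hb, hc, hpow', hpow', inv_pow, hpow, splitRep_rot_apply, hφ]
      simp
    refine homInvariants_adZero_ne_bot_of_isOfForm hf φ (fun g X ↦ ?_) htr (by simp [hφ, hs])
    rcases g with i | i
    · exact hrot (.ofAdd i) X
    · rw [hsri]
      exact map_conj_mul (fun X ↦ by simp [hφ, hsr, hs1]) (hrot (.ofAdd i)) X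

end Split
end Converse

/-! ### The exceptional cases are the only ones -/

section Exceptional

variable {k V : Type*} [Field k] [Finite k] [AddCommGroup V] [Module k V]
variable {H : Subgroup (LinearMap.GeneralLinearGroup k V)} {A : Module.End k V} {d : k}

theorem card_dvd_of_forall_pow_eq_one {G K : Type*} [Group G] [Monoid K] [IsCyclic G]
    {χ : G →* K} (hχ : Function.Injective χ) {m : ℕ} (h : ∀ t, χ t ^ m = 1) :
    Nat.card G ∣ m := by
  obtain ⟨t, ht⟩ := IsCyclic.exists_ofOrder_eq_natCard (α := G)
  rw [← ht, ← orderOf_injective χ hχ]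
  exact orderOf_dvd_of_pow_eq_one (h t)

theorem card_rotations_dvd_sub_one [IsCyclic (rotations H A)] {χ : rotations H A →* k}
    (hinj : Function.Injective χ) : Nat.card (rotations H A) ∣ Nat.card k - 1 :=
  card_dvd_of_forall_pow_eq_one hinj fun t ↦
    pow_natCard_sub_one (χ.toHomUnits t).ne_zero

/-- The values of `χ` are of norm one, that is, killed by `q + 1`. -/
theorem card_rotations_dvd_add_one {k₂ : Type*} [Field k₂] [Algebra k k₂] (h2 : (2 : k) ≠ 0)
    (hd : ∀ c, d ≠ c * c) {α : k₂} (hα : α * α = algebraMap k k₂ d)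
    [IsCyclic (rotations H A)] {χ : rotations H A →* k₂} (hinj : Function.Injective χ)
    (hχ : ∀ t : rotations H A, ∃ a b : k, t.1.val = a • 1 + b • A ∧ a ^ 2 - b ^ 2 * d = 1 ∧
        χ t = algebraMap k k₂ a + algebraMap k k₂ b * α) :
    Nat.card (rotations H A) ∣ Nat.card k + 1 := by
  refine card_dvd_of_forall_pow_eq_one hinj fun t ↦ ?_
  obtain ⟨a, b, -, hab, ht⟩ := hχ t
  rw [pow_succ, ← conj_apply k k₂, ht, conj_algebraMap_add_mul h2 hd hα]
  have h1 : algebraMap k k₂ a ^ 2 - algebraMap k k₂ b ^ 2 * (α * α) = 1 := by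
    rw [hα, ← map_pow, ← map_pow, ← map_mul, ← map_sub, hab, map_one]
  linear_combination h1

namespace NormalizesQuadratic

/-- Apply `exists_eq_pow_of_intertwines` to a generator of the group of rotations. -/
theorem isExceptional_card_rotations {p : ℕ} [Fact p.Prime] [Algebra (ZMod p) k]
    [Module (ZMod p) V] [IsScalarTower (ZMod p) k V] {K : Type*} [Field K] [Finite K] [Algebra k K]
    (hA : NormalizesQuadratic H A d) (hodd : Odd (Nat.card (rotations H A)))
    (hone : 1 < Nat.card (rotations H A)) {α : K} (hα : α * α = algebraMap k K d)
    [IsCyclic (rotations H A)] {χ : rotations H A →* K} (hinj : Function.Injective χ)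
    (hχ : ∀ t : rotations H A, ∃ a b : k, t.1.val = a • 1 + b • A ∧ a ^ 2 - b ^ 2 * d = 1 ∧
        χ t = algebraMap k K a + algebraMap k K b * α)
    {Φ : Module.End k V →ₗ[ZMod p] V} (hΦ0 : Φ ≠ 0)
    (hΦ : ∀ h ∈ H, ∀ X, Φ (h.val * X * h⁻¹.val) = h.val (Φ X))
    (hdvd : Nat.card (rotations H A) ∣ Nat.card k - 1 ∨
      Nat.card (rotations H A) ∣ Nat.card k + 1) :
    IsExceptional p k (Nat.card (rotations H A)) := by
  let _ : Algebra (ZMod p) K := ((algebraMap k K).comp (algebraMap (ZMod p) k)).toAlgebra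
  have : IsScalarTower (ZMod p) k K := IsScalarTower.of_algebraMap_eq fun _ ↦ rfl
  obtain ⟨t, ht⟩ := IsCyclic.exists_ofOrder_eq_natCard (α := rotations H A)
  obtain ⟨a, b, htab, hab, hχt⟩ := hχ t
  let ζ : Kˣ := χ.toHomUnits t
  have hζn : orderOf ζ = Nat.card (rotations H A) := by
    rw [← ht, ← orderOf_units, ← orderOf_injective χ hinj]
    rfl
  have hζ : ζ ≠ 1 := fun h ↦ by
    rw [h, orderOf_one] at hζn
    omega
  have hmul : (a • 1 + b • A) * (a • 1 - b • A) = 1 := by rw [hA.mul_conj, hab, one_smul]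
  have hinv : t.1⁻¹.val = a • 1 - b • A := by
    rw [Units.inv_eq_of_mul_eq_one_right]
    rw [htab, hmul]
  have hζinv : ((ζ⁻¹ : Kˣ) : K) = algebraMap k K a - algebraMap k K b * α := by
    refine Units.inv_eq_of_mul_eq_one_right ?_
    change χ t * _ = 1
    have h1 : algebraMap k K a ^ 2 - algebraMap k K b ^ 2 * (α * α) = 1 := by
      rw [hα, ← map_pow, ← map_pow, ← map_mul, ← map_sub, hab, map_one]
    rw [hχt]
    linear_combination h1
  have hg' : t.1⁻¹.val = (2 * a) • 1 - t.1.val := by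
    rw [hinv, htab]
    module
  have hg : t.1.val * t.1.val = (2 * a) • t.1.val - 1 := by
    have h1 : t.1.val * t.1⁻¹.val = 1 := t.1.mul_inv
    rw [hg', mul_sub, mul_smul_comm, mul_one, sub_eq_iff_eq_add] at h1
    rw [h1, add_sub_cancel_left]
  obtain ⟨i, ε, δ, h⟩ := exists_eq_pow_of_intertwines t.1.mul_inv hg hg' hζ (by
    rw [hζinv]
    change _ = χ t + _
    rw [hχt, map_mul, map_ofNat]
    ring) Φ (hΦ t.1 t.2.1) hΦ0
  obtain ⟨ε', h⟩ := exists_pow_modEq_of_zpow_eq hζn h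
  exact isExceptional_of_modEq hodd hone h hdvd

end NormalizesQuadratic

/-- A nonzero equivariant map rules out scalars `c ≠ 1` in `H`, so that `H` is a
group of rotations, possibly extended by a reflection; the map also forces the order of the group of rotations to be
exceptional. The form depends on whether `d` is a square in `k`, in which case irreducibility
provides a reflection. -/
theorem exists_isOfForm_of_homInvariants_ne_bot {p : ℕ} [Fact p.Prime] [Algebra (ZMod p) k]
    [Module (ZMod p) V] [IsScalarTower (ZMod p) k V] (hV : Module.finrank k V = 2)
    (h2 : (2 : k) ≠ 0) {k₂ : Type*} [Field k₂] [Algebra k k₂] (h₂ : Module.finrank k k₂ = 2)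
    (hH : (tautRep H).IsIrreducible) (hcard : (Nat.card H : k) ≠ 0)
    (h0 : homInvariants (adZero (ZMod p) H).toRepresentation
      (restrictCoeff (ZMod p) (tautRep H)) ≠ ⊥) :
    ∃ n, IsExceptional p k n ∧
      ((∃ ψ' : Cyc n →* normOne k k₂, IsOfForm H ((repJ h₂ ψ').comp (rot n))) ∨
        (∃ ψ : Cyc n →* kˣ, IsOfForm H (repI ψ)) ∨
        ∃ ψ' : Cyc n →* normOne k k₂, IsOfForm H (repJ h₂ ψ')) := by
  have : Module.Finite k V := Module.finite_of_finrank_eq_succ hV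
  have : Finite V := Module.finite_of_finite k
  have : Finite (Module.End k V) := Finite.of_injective _ DFunLike.coe_injective
  have : Module.Finite k k₂ := Module.finite_of_finrank_eq_succ h₂
  have : Finite k₂ := Module.finite_of_finite k
  have hsc : ∀ h ∈ H, ∀ c : k, h.val = c • 1 → h = 1 := fun h hh c hc ↦ by
    by_contra h1
    exact h0 (homInvariants_eq_bot_of_smul_one_mem hh hc h1 _)
  obtain ⟨A, d, hA⟩ := exists_normalizesQuadratic hV h2 hH hcard hsc
  obtain ⟨Φ, hΦ0, hΦ⟩ := exists_intertwining_of_homInvariants_ne_bot hV h2 h0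
  have hodd := hA.odd_card_rotations hV h2 hH hsc
  have hone := hA.one_lt_card_rotations hV h2 hH hsc
  obtain ⟨α, hα⟩ := exists_mul_self_eq_algebraMap h₂ h2 d
  obtain ⟨χ, hinj, hχ⟩ := hA.exists_char hV h2 hH hsc hα
  have : IsCyclic (rotations H A) := isCyclic_of_injective_ringHom χ hinj
  have c : Cyc (Nat.card (rotations H A)) ≃* rotations H A := zmodCyclicMulEquiv inferInstance
  refine ⟨Nat.card (rotations H A), ?_⟩
  by_cases hd : ∃ c, d = c * c
  · obtain ⟨β, hβ⟩ := hd
    obtain ⟨χ₁, hinj₁, hχ₁⟩ := hA.exists_char hV h2 hH hsc (K := k) (α := β) hβ.symm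
    have hs : ∃ s ∈ H, s.val * A = -(A * s.val) := by
      by_contra! hs
      refine mul_self_ne_of_isIrreducible hH hA.ne_smul_one
        (fun h hh ↦ (hA.commute_or h hh).resolve_right (hs h hh)) β ?_
      rw [hA.mul_self, hβ]
    obtain ⟨s, hs, hsA⟩ := hs
    exact ⟨hA.isExceptional_card_rotations hodd hone (K := k) hβ.symm hinj₁ hχ₁ hΦ0 hΦ
        (.inl (card_rotations_dvd_sub_one hinj₁)),
      .inr (.inl (hA.exists_isOfForm_repI hV h2 hsc hβ.symm c hχ₁ hs hsA))⟩
  · push Not at hd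
    refine ⟨hA.isExceptional_card_rotations hodd hone hα hinj hχ hΦ0 hΦ
      (.inr (card_rotations_dvd_add_one h2 hd hα hinj hχ)), ?_⟩
    by_cases hcomm : ∀ h ∈ H, h.val * A = A * h.val
    · exact .inl (hA.exists_isOfForm_repJ_rot hV h2 h₂ hd hα c hχ hcomm)
    · push Not at hcomm
      obtain ⟨s, hs, hsA⟩ := hcomm
      exact .inr (.inr (hA.exists_isOfForm_repJ hV h2 hsc h₂ hd hα c hχ hs
        ((hA.commute_or s hs).resolve_left hsA)))

end Exceptional

end PlaneRep

end

theorem theorem5p16 (p : ℕ) [Fact p.Prime] (hp : p ≠ 2)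
    (k : Type u) [Field k] [Finite k] [Algebra (ZMod p) k]
    (V : Type u) [AddCommGroup V] [Module k V] [Module (ZMod p) V] [IsScalarTower (ZMod p) k V]
    (hV : Module.finrank k V = 2)
    (k₂ : Type*) [Field k₂] [Algebra k k₂] (h₂ : Module.finrank k k₂ = 2)
    (H : Subgroup (LinearMap.GeneralLinearGroup k V))
    (hH : (PlaneRep.tautRep H).IsSemisimpleRepresentation) :
    (∀ i : ℕ, 0 < i → Subsingleton (groupCohomology (Rep.of (PlaneRep.tautRep H)) i)) ∧
    ((PlaneRep.tautRep H).IsIrreducible →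
      List.TFAE [
        ∀ W : Subrepresentation (PlaneRep.adRep (ZMod p) H),
          PlaneRep.homInvariants W.toRepresentation
            (PlaneRep.restrictCoeff (ZMod p) (PlaneRep.tautRep H)) = ⊥,
        PlaneRep.homInvariants (PlaneRep.adZero (ZMod p) H).toRepresentation
            (PlaneRep.restrictCoeff (ZMod p) (PlaneRep.tautRep H)) = ⊥,
        ∀ n : ℕ, PlaneRep.IsExceptional p k n →
          (∀ ψ' : PlaneRep.Cyc n →* PlaneRep.normOne k k₂,
            ¬ PlaneRep.IsOfForm H ((PlaneRep.repJ h₂ ψ').comp (PlaneRep.rot n))) ∧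
          (∀ ψ : PlaneRep.Cyc n →* kˣ, ¬ PlaneRep.IsOfForm H (PlaneRep.repI ψ)) ∧
          (∀ ψ' : PlaneRep.Cyc n →* PlaneRep.normOne k k₂,
            ¬ PlaneRep.IsOfForm H (PlaneRep.repJ h₂ ψ'))]) := by
  have : CharP k p := charP_of_injective_algebraMap' (ZMod p) p
  have h2 : (2 : k) ≠ 0 := fun h ↦ hp <|
    (Nat.prime_dvd_prime_iff_eq Fact.out Nat.prime_two).1
      ((CharP.cast_eq_zero_iff k p 2).1 (by exact_mod_cast h))
  have : Module.Finite k V := Module.finite_of_finrank_eq_succ hV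
  have : Finite V := Module.finite_of_finite k
  have : Finite (Module.End k V) := Finite.of_injective _ DFunLike.coe_injective
  have : Nontrivial V := Module.nontrivial_of_finrank_pos (R := k) (by omega)
  have hneg : (-1 : k) ≠ 1 := fun h ↦ h2 (by linear_combination -h)
  have hcard (h : ¬ p ∣ Nat.card H) : (Nat.card H : k) ≠ 0 :=
    fun h1 ↦ h ((CharP.cast_eq_zero_iff k p _).1 h1)
  have hval : (-1 : LinearMap.GeneralLinearGroup k V).val = (-1 : k) • 1 := by simp
  have hne : (-1 : LinearMap.GeneralLinearGroup k V) ≠ 1 := PlaneRep.neg_one_ne_one h2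
  refine ⟨fun i hi ↦ ?_, fun hirr ↦ ?_⟩
  · by_cases hpH : p ∣ Nat.card H
    · have hz := PlaneRep.neg_one_mem_of_dvd_card hV h2 p H hH hpH
      refine PlaneRep.subsingleton_groupCohomology_of_central (z := ⟨-1, hz⟩) ?_ _ hneg hval hi
      rw [Subgroup.mem_center_iff]
      intro g
      exact Subtype.ext (by simp)
    · exact PlaneRep.subsingleton_groupCohomology_of_card_ne_zero (hcard hpH) _ hi
  · tfae_have 1 → 2 := fun h ↦ h _
    tfae_have 2 → 1 := fun h W ↦ by
      by_cases hpH : p ∣ Nat.card H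
      · exact PlaneRep.homInvariants_eq_bot_of_smul_one_mem
          (PlaneRep.neg_one_mem_of_dvd_card hV h2 p H hH hpH) hval hne W
      · exact PlaneRep.homInvariants_eq_bot_of_adZero hV h2 hirr (hcard hpH) h W
    tfae_have 2 → 3 := fun h n hn ↦ by
      have hmul {ψ' : PlaneRep.Cyc n →* PlaneRep.normOne k k₂} {a : PlaneRep.Cyc n}
          (ha : ψ' a = 1) : PlaneRep.repJ h₂ ψ' (PlaneRep.rot n a) = 1 := by
        change PlaneRep.mulChar ψ' a = 1
        rw [← PlaneRep.mulChar_one ψ', PlaneRep.mulChar, PlaneRep.mulChar, ha, map_one]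
      refine ⟨fun ψ' hf ↦ ?_, fun ψ hf ↦ PlaneRep.homInvariants_ne_bot_of_split h2 hn ψ hf h,
        fun ψ' hf ↦ ?_⟩
      · exact PlaneRep.homInvariants_ne_bot_of_nonsplit h2 h₂ hn ψ'
          (fun a ha ↦ PlaneRep.isOfForm_injective hf (hmul ha)) (.inl hf) h
      · refine PlaneRep.homInvariants_ne_bot_of_nonsplit h2 h₂ hn ψ' (fun a ha ↦ ?_) (.inr hf) h
        exact DihedralGroup.r.inj (PlaneRep.isOfForm_injective hf (hmul ha))
    tfae_have 3 → 2 := fun h ↦ by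
      by_contra h0
      have hpH : ¬ p ∣ Nat.card H := fun hpH ↦
        h0 (PlaneRep.homInvariants_eq_bot_of_smul_one_mem
          (PlaneRep.neg_one_mem_of_dvd_card hV h2 p H hH hpH) hval hne _)
      obtain ⟨n, hn, ⟨ψ', hf⟩ | ⟨ψ, hf⟩ | ⟨ψ', hf⟩⟩ :=
        PlaneRep.exists_isOfForm_of_homInvariants_ne_bot hV h2 h₂ hirr (hcard hpH) h0
      · exact (h n hn).1 ψ' hf
      · exact (h n hn).2.1 ψ hf
      · exact (h n hn).2.2 ψ' hf
    tfae_finish
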